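/- For every $a\in\mathbb{R}$, $$\sum_{n=1}^{\infty}\frac{(-1)^n}{n}\,\beta_n\,J_{2n}(a)=\int_{0}^{\infty}\bigl[\gamma+\log t-\mathrm{Ci}(t)\bigr]\,J_{0}\bigl(\sqrt{a^2+t^2}\bigr)\,\frac{\mathrm{d}t}{t},$$ where the series and the integral both converge absolutely. Here $\gamma$ is Euler's constant; for integers $\nu\ge 0$ and real $z$, $$J_\nu(z)=\sum_{k=0}^{\infty}\frac{(-1)^k}{k!\,\Gamma(\nu+k+1)}\left(\frac z2\right)^{2k+\nu}$$ is the Bessel function of the first kind; for $x>0$, $$\mathrm{Ci}(x)=\gamma+\log x+\int_0^x\frac{\cos t-1}{t}\,\mathrm{d}t$$ is the cosine integral; and for $n\ge 1$, $$\beta_n=H_n+A_n-\frac1{2n}-\frac{(-1)^{n-1}}{2n},\qquad H_n=\sum_{k=1}^n\frac1k,\qquad A_n=\sum_{k=1}^n\frac{(-1)^{k-1}}{k}.$$ -/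

import Mathlib

open MeasureTheory

noncomputable section

/-- The Bessel function of the first kind `J_ν`, for `ν = 0, 1, 2, …`, at a real argument:
`J_ν(z) = ∑_{k ≥ 0} (-1)^k / (k! Γ(ν + k + 1)) (z / 2)^(2 k + ν)`.
The series converges absolutely for every real `z`. -/
def besselJ (ν : ℕ) (z : ℝ) : ℝ :=
  ∑' k : ℕ, (-1 : ℝ) ^ k / ((k.factorial : ℝ) * Real.Gamma ((ν : ℝ) + (k : ℝ) + 1))
    * (z / 2) ^ (2 * k + ν)

/-- The cosine integral
`Ci(x) = γ + log x + ∫_0^x (cos t - 1) / t dt`, for `x > 0`.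
The integrand is bounded, so that the integral converges. -/
def cosIntegral (x : ℝ) : ℝ :=
  Real.eulerMascheroniConstant + Real.log x + ∫ t in (0 : ℝ)..x, (Real.cos t - 1) / t

/-- The harmonic number `H_n = ∑_{k=1}^n 1 / k`, as a real number. -/
def harmonicNumber (n : ℕ) : ℝ :=
  ∑ k ∈ Finset.Icc 1 n, 1 / (k : ℝ)

/-- The alternating harmonic number `A_n = ∑_{k=1}^n (-1)^(k-1) / k`. -/
def altHarmonicNumber (n : ℕ) : ℝ :=
  ∑ k ∈ Finset.Icc 1 n, (-1 : ℝ) ^ (k - 1) / (k : ℝ)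

/-- The coefficient `β_n = H_n + A_n - 1 / (2 n) - (-1)^(n-1) / (2 n)`, for `n ≥ 1`. -/
def neumannBeta (n : ℕ) : ℝ :=
  harmonicNumber n + altHarmonicNumber n - 1 / (2 * (n : ℝ)) - (-1 : ℝ) ^ (n - 1) / (2 * (n : ℝ))

end

/-! The bracket γ + log t − Ci(t) is the entire function Cin(t) = ∫₀ᵗ (1 − cos u)/u du. Graf's
addition theorem for orthogonal arguments, J₀(√(a²+t²)) = J₀(a)J₀(t) + 2 ∑_{m≥1} (−1)^m J_{2m}(a)
J_{2m}(t) (`hasSum_graf`), separates a from t. After multiplication by Cin(t)/t and termwise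
integration, the identity reduces to ∫ Cin(t) J_{2m}(t) dt/t = β_m/(2m) for m ≥ 1 and ∫ Cin(t) J₀(t)
dt/t = 0.

To evaluate these, the substitution u = t sin φ gives Cin(t) = ∫₀^{π/2} (1 − cos(t sin φ)) cot φ dφ.
By Fubini the inner integral becomes ∫ (1 − cos(t sin φ)) J_n(t) dt/t = (1 − cos nφ)/n for n ≥ 1, a
boundary value of the Laplace transform of J_n(t)/t (`integral_exp_sin_mul_div`). What remains,
∫₀^{π/2} cot φ (1 − cos 2nφ) dφ = β_n, follows by induction on n. For n = 0 the recurrence J₀ =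
2J₁/t − J₂ shows that the inner integral vanishes.

Convergence rests on |J_n(t)| ≤ min(1, 5·3ⁿ/√t) and |Cin(t)| ≤ 8 t^{1/4}: each integrand is at most
a constant times 3ⁿ times one integrable function of t. The factor 3ⁿ is harmless because J_n(a)
decays factorially in n. -/

/-- Bessel's integral for `J_n(t)`, with `n` an arbitrary integer. -/
noncomputable def besselIntegral (n : ℤ) (t : ℝ) : ℝ :=
  (1 / (2 * Real.pi)) * ∫ θ in (0 : ℝ)..2 * Real.pi, Real.cos (n * θ - t * Real.sin θ)

/-! ### Bessel's integral: derivative, recurrence, parity -/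

namespace besselIntegral

theorem abs_le_one (n : ℤ) (t : ℝ) : |besselIntegral n t| ≤ 1 := by
  have h : ‖∫ θ in (0 : ℝ)..2 * Real.pi, Real.cos (n * θ - t * Real.sin θ)‖
      ≤ 1 * |2 * Real.pi - 0| :=
    intervalIntegral.norm_integral_le_of_norm_le_const fun x _ => Real.abs_cos_le_one _
  have hp := Real.pi_pos
  rw [besselIntegral, abs_mul, abs_of_pos (by positivity)]
  rw [sub_zero, abs_of_pos (by positivity : 0 < 2 * Real.pi), Real.norm_eq_abs] at h
  rw [div_mul_eq_mul_div, div_le_one (by positivity)]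
  linarith

theorem integral_deriv_eq (n : ℤ) (t : ℝ) :
    (1 / (2 * Real.pi)) * ∫ θ in (0 : ℝ)..2 * Real.pi,
      Real.sin (n * θ - t * Real.sin θ) * Real.sin θ
      = (besselIntegral (n - 1) t - besselIntegral (n + 1) t) / 2 := by
  have : ∀ θ : ℝ, Real.sin (n * θ - t * Real.sin θ) * Real.sin θ
      = (Real.cos (((n - 1 : ℤ) : ℝ) * θ - t * Real.sin θ)
        - Real.cos (((n + 1 : ℤ) : ℝ) * θ - t * Real.sin θ)) / 2 := by
    intro θ
    have h1 : ((n - 1 : ℤ) : ℝ) * θ - t * Real.sin θ = (n * θ - t * Real.sin θ) - θ := by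
      push_cast; ring
    have h2 : ((n + 1 : ℤ) : ℝ) * θ - t * Real.sin θ = (n * θ - t * Real.sin θ) + θ := by
      push_cast; ring
    rw [h1, h2, Real.cos_sub, Real.cos_add]; ring
  simp_rw [this]
  rw [intervalIntegral.integral_div, intervalIntegral.integral_sub]
  · simp only [besselIntegral]; ring
  all_goals exact Continuous.intervalIntegrable (by fun_prop) _ _

theorem hasDerivAt (n : ℤ) (t : ℝ) :
    HasDerivAt (besselIntegral n)
      ((besselIntegral (n - 1) t - besselIntegral (n + 1) t) / 2) t := by
  rw [← integral_deriv_eq]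
  refine HasDerivAt.const_mul _ ?_
  refine (intervalIntegral.hasDerivAt_integral_of_dominated_loc_of_deriv_le
    (F := fun t θ => Real.cos (n * θ - t * Real.sin θ))
    (F' := fun t θ => Real.sin (n * θ - t * Real.sin θ) * Real.sin θ) (bound := fun _ => 1)
    Filter.univ_mem ?_ ?_ ?_ ?_ ?_ ?_).2
  · exact Filter.Eventually.of_forall fun x => Continuous.aestronglyMeasurable (by fun_prop)
  · exact Continuous.intervalIntegrable (by fun_prop) _ _
  · exact Continuous.aestronglyMeasurable (by fun_prop)
  · refine Filter.Eventually.of_forall fun θ _ x _ => ?_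
    rw [norm_mul]
    exact mul_le_one₀ (Real.abs_sin_le_one _) (norm_nonneg _) (Real.abs_sin_le_one _)
  · exact Continuous.intervalIntegrable (by fun_prop) _ _
  · refine Filter.Eventually.of_forall fun θ _ x _ => ?_
    have h : HasDerivAt (fun x : ℝ => n * θ - x * Real.sin θ) (-Real.sin θ) x := by
      simpa using ((hasDerivAt_id x).mul_const (Real.sin θ)).const_sub ((n : ℝ) * θ)
    exact h.cos.congr_deriv (by ring)

theorem continuous (n : ℤ) : Continuous (besselIntegral n) :=
  continuous_iff_continuousAt.2 fun t => (hasDerivAt n t).continuousAt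

/-- The derivative in θ of sin(nθ − t sin θ) integrates to zero over a period. -/
theorem recurrence (n : ℤ) (t : ℝ) :
    2 * n * besselIntegral n t
      = t * (besselIntegral (n - 1) t + besselIntegral (n + 1) t) := by
  have h0 : ∫ θ in (0 : ℝ)..2 * Real.pi,
      Real.cos (n * θ - t * Real.sin θ) * (n - t * Real.cos θ) = 0 := by
    rw [intervalIntegral.integral_eq_sub_of_hasDerivAt
      (f := fun θ => Real.sin (n * θ - t * Real.sin θ))]
    · simp [← mul_assoc]
      have h := Real.sin_int_mul_pi (n * 2)
      push_cast at h
      exact h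
    · intro x _
      have h := (((hasDerivAt_id x).const_mul (n : ℝ)).sub ((Real.hasDerivAt_sin x).const_mul t)).sin
      simpa using h
    · exact Continuous.intervalIntegrable (by fun_prop) _ _
  have : ∀ θ : ℝ, Real.cos (n * θ - t * Real.sin θ) * (n - t * Real.cos θ)
      = n * Real.cos (n * θ - t * Real.sin θ)
        - (t / 2) * (Real.cos (((n - 1 : ℤ) : ℝ) * θ - t * Real.sin θ)
        + Real.cos (((n + 1 : ℤ) : ℝ) * θ - t * Real.sin θ)) := by
    intro θ
    have h1 : ((n - 1 : ℤ) : ℝ) * θ - t * Real.sin θ = (n * θ - t * Real.sin θ) - θ := by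
      push_cast; ring
    have h2 : ((n + 1 : ℤ) : ℝ) * θ - t * Real.sin θ = (n * θ - t * Real.sin θ) + θ := by
      push_cast; ring
    rw [h1, h2, Real.cos_sub _ θ, Real.cos_add _ θ]; ring
  simp_rw [this] at h0
  rw [intervalIntegral.integral_sub, intervalIntegral.integral_const_mul,
    intervalIntegral.integral_const_mul, intervalIntegral.integral_add] at h0
  · simp only [besselIntegral]
    linear_combination (1 / Real.pi) * h0
  all_goals exact Continuous.intervalIntegrable (by fun_prop) _ _

/-- Translating θ by π changes the sign of sin θ and contributes the phase nπ. -/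
theorem neg_order (n : ℤ) (t : ℝ) :
    besselIntegral (-n) t = (-1) ^ n * besselIntegral n t := by
  have hper : Function.Periodic
      (fun θ : ℝ => Real.cos (((-n : ℤ) : ℝ) * θ - t * Real.sin θ)) (2 * Real.pi) := by
    intro θ
    have : ((-n : ℤ) : ℝ) * (θ + 2 * Real.pi) - t * Real.sin (θ + 2 * Real.pi)
      = (((-n : ℤ) : ℝ) * θ - t * Real.sin θ) + ((-n : ℤ) : ℝ) * (2 * Real.pi) := by
      rw [Real.sin_add_two_pi]; ring
    simp only [this, Real.cos_add_int_mul_two_pi]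
  have h := hper.intervalIntegral_add_eq 0 Real.pi
  have h2 : ∫ θ in Real.pi..Real.pi + 2 * Real.pi,
      Real.cos (((-n : ℤ) : ℝ) * θ - t * Real.sin θ)
      = ∫ θ in (0 : ℝ)..2 * Real.pi, (-1) ^ n * Real.cos (n * θ - t * Real.sin θ) := by
    have := intervalIntegral.integral_comp_add_right (a := 0) (b := 2 * Real.pi)
      (fun θ : ℝ => Real.cos (((-n : ℤ) : ℝ) * θ - t * Real.sin θ)) Real.pi
    rw [zero_add, add_comm (2 * Real.pi)] at this
    rw [← this]
    congr 1
    ext θ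
    have e : ((-n : ℤ) : ℝ) * (θ + Real.pi) - t * Real.sin (θ + Real.pi)
      = -((n * θ - t * Real.sin θ) + n * Real.pi) := by
      rw [Real.sin_add_pi]; push_cast; ring
    rw [e, Real.cos_neg, Real.cos_add_int_mul_pi]
  simp only [besselIntegral]
  rw [zero_add] at h
  rw [h, h2, intervalIntegral.integral_const_mul]
  ring

theorem hasDerivAt_zero (t : ℝ) :
    HasDerivAt (besselIntegral 0) (-besselIntegral 1 t) t := by
  have h := hasDerivAt 0 t
  have h1 := neg_order 1 t
  simp only [zpow_one] at h1
  convert h using 1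
  simp only [zero_sub, zero_add, h1]
  ring

/-! ### Power series of Bessel's integral -/

theorem integral_sin_eq_zero (n : ℤ) (t : ℝ) :
    ∫ θ in (0 : ℝ)..2 * Real.pi, Real.sin (n * θ - t * Real.sin θ) = 0 := by
  have h := intervalIntegral.integral_comp_sub_left (a := 0) (b := 2 * Real.pi)
    (fun θ : ℝ => Real.sin (n * θ - t * Real.sin θ)) (2 * Real.pi)
  simp only [sub_self, sub_zero] at h
  have h2 : ∀ θ : ℝ, Real.sin (n * (2 * Real.pi - θ) - t * Real.sin (2 * Real.pi - θ))
      = -Real.sin (n * θ - t * Real.sin θ) := by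
    intro θ
    have e : n * (2 * Real.pi - θ) - t * Real.sin (2 * Real.pi - θ)
      = -(n * θ - t * Real.sin θ) + n * (2 * Real.pi) := by
      rw [Real.sin_two_pi_sub]; ring
    rw [e, Real.sin_add_int_mul_two_pi, Real.sin_neg]
  simp_rw [h2] at h
  rw [intervalIntegral.integral_neg] at h
  linarith

theorem ofReal_eq_integral_exp (n : ℤ) (t : ℝ) :
    ((besselIntegral n t : ℝ) : ℂ) = (1 / (2 * Real.pi)) * ∫ θ in (0 : ℝ)..2 * Real.pi,
      Complex.exp ((t * Real.sin θ - n * θ : ℝ) * Complex.I) := by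
  have h : ∀ θ : ℝ, Complex.exp ((t * Real.sin θ - n * θ : ℝ) * Complex.I)
      = ((Real.cos (n * θ - t * Real.sin θ) : ℝ) : ℂ)
        - ((Real.sin (n * θ - t * Real.sin θ) : ℝ) : ℂ) * Complex.I := by
    intro θ
    rw [Complex.exp_mul_I, ← neg_sub (n * θ) (t * Real.sin θ), Complex.ofReal_neg,
      Complex.cos_neg, Complex.sin_neg]
    push_cast
    ring
  simp_rw [h]
  rw [intervalIntegral.integral_sub, intervalIntegral.integral_mul_const,
    intervalIntegral.integral_ofReal, intervalIntegral.integral_ofReal,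
    integral_sin_eq_zero]
  · simp [besselIntegral]
  all_goals exact Continuous.intervalIntegrable (by fun_prop) _ _

theorem integral_exp_int_mul (l : ℤ) :
    ∫ θ in (0 : ℝ)..2 * Real.pi, Complex.exp ((l * θ : ℝ) * Complex.I)
      = if l = 0 then 2 * (Real.pi : ℂ) else 0 := by
  split_ifs with h
  · subst h; simp
  · have hc : (l : ℂ) * Complex.I ≠ 0 := mul_ne_zero (by exact_mod_cast h) Complex.I_ne_zero
    have e : ∀ θ : ℝ, Complex.exp ((l * θ : ℝ) * Complex.I)
        = Complex.exp ((l : ℂ) * Complex.I * θ) := by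
      intro θ; congr 1; push_cast; ring
    simp_rw [e]
    rw [integral_exp_mul_complex hc]
    have : (l : ℂ) * Complex.I * ((2 * Real.pi : ℝ) : ℂ) = l * (2 * Real.pi * Complex.I) := by
      push_cast; ring
    rw [this, Complex.exp_int_mul_two_pi_mul_I]
    simp

theorem hasSum_pow_div_factorial_real (x : ℝ) :
    HasSum (fun n : ℕ => x ^ n / (n.factorial : ℝ)) (Real.exp x) := by
  rw [Real.exp_eq_exp_ℝ]
  exact NormedSpace.expSeries_div_hasSum_exp x

theorem hasSum_pow_div_factorial_complex (x : ℂ) :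
    HasSum (fun n : ℕ => x ^ n / (n.factorial : ℂ)) (Complex.exp x) := by
  rw [Complex.exp_eq_exp_ℂ]
  exact NormedSpace.expSeries_div_hasSum_exp x

/-- With w = e^{iθ}, e^{it sin θ} = e^{(t/2)w} e^{−(t/2)/w}; this is the product of the two
exponential series. Integration over θ then keeps only the pairs whose indices differ by m. -/
theorem hasSum_exp_sin (m : ℤ) (t θ : ℝ) :
    HasSum (fun p : ℕ × ℕ =>
      (((t / 2) ^ p.1 / (p.1.factorial : ℝ) * ((-(t / 2)) ^ p.2 / (p.2.factorial : ℝ)) : ℝ) : ℂ)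
        * Complex.exp ((((p.1 - p.2 - m : ℤ) : ℝ) * θ : ℝ) * Complex.I))
      (Complex.exp ((t * Real.sin θ - m * θ : ℝ) * Complex.I)) := by
  have h1 := hasSum_pow_div_factorial_complex ((t / 2 : ℂ) * Complex.exp (θ * Complex.I))
  have h2 := hasSum_pow_div_factorial_complex
    (-(t / 2 : ℂ) * Complex.exp (-(θ * Complex.I)))
  have hs := summable_mul_of_summable_norm h1.summable.norm h2.summable.norm
  have h3 := (h1.mul h2 hs).mul_right (Complex.exp (-(m * θ) * Complex.I))
  rw [← Complex.exp_add, ← Complex.exp_add] at h3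
  have hL : t / 2 * Complex.exp (θ * Complex.I) + -(t / 2 : ℂ) * Complex.exp (-(θ * Complex.I))
      + -(m * θ) * Complex.I = (t * Real.sin θ - m * θ : ℝ) * Complex.I := by
    push_cast
    rw [Complex.sin, show -(θ * Complex.I) = -θ * Complex.I by ring]
    linear_combination
      (t / 2 * (Complex.exp (-θ * Complex.I) - Complex.exp (θ * Complex.I))) * (-Complex.I_sq)
  rw [hL] at h3
  refine h3.congr_fun fun p => ?_
  have : Complex.exp ((((p.1 - p.2 - m : ℤ) : ℝ) * θ : ℝ) * Complex.I)
      = Complex.exp (θ * Complex.I) ^ p.1 * Complex.exp (-(θ * Complex.I)) ^ p.2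
        * Complex.exp (-(m * θ) * Complex.I) := by
    rw [← Complex.exp_nat_mul, ← Complex.exp_nat_mul, ← Complex.exp_add, ← Complex.exp_add]
    congr 1; push_cast; ring
  rw [this, mul_pow, mul_pow]
  push_cast
  ring

theorem hasSum_double (m : ℤ) (t : ℝ) :
    HasSum (fun p : ℕ × ℕ =>
      ((t / 2) ^ p.1 / (p.1.factorial : ℝ) * ((-(t / 2)) ^ p.2 / (p.2.factorial : ℝ)))
        * if (p.1 - p.2 - m : ℤ) = 0 then 1 else 0)
      (besselIntegral m t) := by
  have hs : Summable fun p : ℕ × ℕ =>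
      ‖(t / 2) ^ p.1 / (p.1.factorial : ℝ) * ((-(t / 2)) ^ p.2 / (p.2.factorial : ℝ))‖ :=
    (summable_mul_of_summable_norm
      (NormedSpace.norm_expSeries_div_summable (t / 2))
      (NormedSpace.norm_expSeries_div_summable (-(t / 2)))).norm
  have h := intervalIntegral.hasSum_integral_of_dominated_convergence (μ := volume)
    (a := 0) (b := 2 * Real.pi)
    (fun (p : ℕ × ℕ) _ =>
      ‖(t / 2) ^ p.1 / (p.1.factorial : ℝ) * ((-(t / 2)) ^ p.2 / (p.2.factorial : ℝ))‖)
    (fun p => Continuous.aestronglyMeasurable (by fun_prop))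
    (fun p => Filter.Eventually.of_forall fun θ _ => by
      rw [norm_mul, Complex.norm_exp_ofReal_mul_I, mul_one, Complex.norm_real])
    (Filter.Eventually.of_forall fun θ _ => hs)
    (Continuous.intervalIntegrable (by fun_prop) _ _)
    (Filter.Eventually.of_forall fun θ _ => hasSum_exp_sin m t θ)
  replace h := h.mul_left (1 / (2 * (Real.pi : ℂ)))
  rw [← ofReal_eq_integral_exp] at h
  rw [← Complex.hasSum_ofReal]
  refine h.congr_fun fun p => ?_
  rw [intervalIntegral.integral_const_mul, integral_exp_int_mul]
  have : (Real.pi : ℂ) ≠ 0 := by exact_mod_cast Real.pi_ne_zero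
  split_ifs
  · push_cast; field_simp
  · simp

theorem hasSum_nat (m : ℕ) (t : ℝ) :
    HasSum (fun k : ℕ =>
      (t / 2) ^ (k + m) / ((k + m).factorial : ℝ) * ((-(t / 2)) ^ k / (k.factorial : ℝ)))
      (besselIntegral m t) := by
  have h := hasSum_double m t
  have hi : Function.Injective fun k : ℕ => (k + m, k) := fun a b hab => (Prod.ext_iff.1 hab).2
  rw [← hi.hasSum_iff] at h
  · convert h using 1
    ext k
    simp
  · rintro ⟨j, k⟩ hjk
    rw [if_neg, mul_zero]
    intro h0
    refine hjk ⟨k, ?_⟩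
    simp only [Prod.mk.injEq, and_true]
    simp only at h0
    omega

theorem eq_besselJ (m : ℕ) (t : ℝ) : besselIntegral m t = besselJ m t := by
  rw [← (hasSum_nat m t).tsum_eq, besselJ]
  congr 1
  ext k
  have : (m : ℝ) + k + 1 = ((k + m : ℕ) : ℝ) + 1 := by push_cast; ring
  rw [this, Real.Gamma_nat_eq_factorial, neg_pow, show 2 * k + m = (k + m) + k by ring, pow_add]
  ring

/-- Since (k+m)! ≥ m!, the power series is dominated by an exponential series. The factorial later
absorbs the factor 3ⁿ. -/
theorem abs_le_mul_exp (m : ℕ) (t : ℝ) :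
    |besselIntegral m t| ≤ |t / 2| ^ m / m.factorial * Real.exp (|t / 2| ^ 2) := by
  have h1 : HasSum (fun k : ℕ => |t / 2| ^ m / m.factorial * ((|t / 2| ^ 2) ^ k / k.factorial))
      (|t / 2| ^ m / m.factorial * Real.exp (|t / 2| ^ 2)) :=
    (hasSum_pow_div_factorial_real (|t / 2| ^ 2)).mul_left (|t / 2| ^ m / m.factorial)
  rw [← (hasSum_nat m t).tsum_eq, ← Real.norm_eq_abs]
  refine tsum_of_norm_bounded h1 fun k => ?_
  have h2 : |t / 2| ^ (k + m) / ((k + m).factorial : ℝ) ≤ |t / 2| ^ (k + m) / (m.factorial : ℝ) :=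
    div_le_div_of_nonneg_left (by positivity) (by positivity)
      (by exact_mod_cast Nat.factorial_le (Nat.le_add_left m k))
  have h3 : ‖(t / 2) ^ (k + m) / ((k + m).factorial : ℝ) * ((-(t / 2)) ^ k / (k.factorial : ℝ))‖
      = |t / 2| ^ (k + m) / ((k + m).factorial : ℝ) * (|t / 2| ^ k / (k.factorial : ℝ)) := by
    rw [norm_mul, norm_div, norm_div, norm_pow, norm_pow, norm_neg, Real.norm_natCast,
      Real.norm_natCast, Real.norm_eq_abs]
  rw [h3]
  refine (mul_le_mul_of_nonneg_right h2 (by positivity)).trans (le_of_eq ?_)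
  ring

/-! ### Decay of order t^(-1/2) -/

/-- A first integral of Bessel's equation up to lower order terms; it controls `J₀² + J₁²`. -/
noncomputable def energy (t : ℝ) : ℝ :=
  t * (besselIntegral 0 t ^ 2 + besselIntegral 1 t ^ 2) - besselIntegral 0 t * besselIntegral 1 t

theorem hasDerivAt_energy {t : ℝ} (ht : t ≠ 0) :
    HasDerivAt energy (besselIntegral 0 t * besselIntegral 1 t / t) t := by
  have h0 := hasDerivAt_zero t
  have h1 := hasDerivAt 1 t
  have hr := recurrence 1 t
  norm_num at h1 hr
  have h := ((hasDerivAt_id t).mul ((h0.pow 2).add (h1.pow 2))).sub (h0.mul h1)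
  refine h.congr_deriv ?_
  have hr' : besselIntegral 2 t = 2 * besselIntegral 1 t / t - besselIntegral 0 t := by
    field_simp; linarith
  simp only [Pi.pow_apply, Pi.add_apply, id, hr']
  field_simp
  ring

/-- For t ≥ 1, |J₀J₁| ≤ (J₀² + J₁²)/2 makes the energy E at least t(J₀² + J₁²)/2, so that E' =
J₀J₁/t ≤ E/t². The integrating factor of this inequality is e^{1/t}. -/
theorem energy_mul_exp_antitone :
    AntitoneOn (fun t => energy t * Real.exp (1 / t)) (Set.Ici 1) := by
  have hd : ∀ t : ℝ, 0 < t → HasDerivAt (fun t => energy t * Real.exp (1 / t))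
      (besselIntegral 0 t * besselIntegral 1 t / t * Real.exp (1 / t)
        + energy t * (Real.exp (1 / t) * (-(t ^ 2)⁻¹))) t := by
    intro t ht
    have h2 : HasDerivAt (fun t : ℝ => 1 / t) (-(t ^ 2)⁻¹) t := by
      simpa using hasDerivAt_inv ht.ne'
    exact (hasDerivAt_energy ht.ne').mul h2.exp
  refine antitoneOn_of_deriv_nonpos (convex_Ici 1) ?_ ?_ ?_
  · exact fun t ht => (hd t (lt_of_lt_of_le one_pos ht)).continuousAt.continuousWithinAt
  · rw [interior_Ici]
    exact fun t ht => (hd t (lt_trans one_pos ht)).differentiableAt.differentiableWithinAt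
  · rw [interior_Ici]
    intro t ht
    have ht1 : 1 < t := ht
    have ht0 : 0 < t := by linarith
    rw [(hd t ht0).deriv]
    have e : besselIntegral 0 t * besselIntegral 1 t / t * Real.exp (1 / t)
        + energy t * (Real.exp (1 / t) * (-(t ^ 2)⁻¹))
        = -(Real.exp (1 / t) / t ^ 2 * ((t + 1) / 2 * (besselIntegral 0 t - besselIntegral 1 t) ^ 2
          + (t - 1) / 2 * (besselIntegral 0 t ^ 2 + besselIntegral 1 t ^ 2))) := by
      simp only [energy]
      field_simp
      ring
    rw [e, neg_nonpos]
    have : 0 < t - 1 := by linarith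
    positivity

theorem sq_add_sq_le {t : ℝ} (ht : 1 ≤ t) :
    t * (besselIntegral 0 t ^ 2 + besselIntegral 1 t ^ 2) ≤ 18 := by
  have h := energy_mul_exp_antitone (Set.mem_Ici.2 le_rfl) (Set.mem_Ici.2 ht) ht
  simp only [div_one] at h
  -- The chain is t(J₀² + J₁²) ≤ 2E(t) ≤ 2e·E(1) ≤ 6e < 18. The later constant 5 needs only 18 ≤ 25.
  have he := Real.exp_one_lt_d9
  have h1 : energy 1 ≤ 3 := by
    have a0 := abs_le.1 (abs_le_one 0 1)
    have a1 := abs_le.1 (abs_le_one 1 1)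
    simp only [energy]
    nlinarith
  have h2 : t / 2 * (besselIntegral 0 t ^ 2 + besselIntegral 1 t ^ 2) ≤ energy t := by
    simp only [energy]
    nlinarith [sq_nonneg (besselIntegral 0 t - besselIntegral 1 t),
      sq_nonneg (besselIntegral 0 t), sq_nonneg (besselIntegral 1 t)]
  have h3 : 0 ≤ energy t := le_trans (by positivity) h2
  have h4 : energy t ≤ energy t * Real.exp (1 / t) :=
    le_mul_of_one_le_right h3 (Real.one_le_exp (by positivity))
  have h5 : energy 1 * Real.exp 1 ≤ 3 * Real.exp 1 :=
    mul_le_mul_of_nonneg_right h1 (Real.exp_pos 1).le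
  linarith

/-- For t ≤ n + 1 the bound |J_n| ≤ 1 suffices. For larger t the upward recurrence has coefficient
at most 2, so each order costs at most a factor 3. -/
theorem sqrt_mul_abs_le (n : ℕ) (t : ℝ) : √t * |besselIntegral n t| ≤ 5 * 3 ^ n := by
  have htriv : ∀ k : ℕ, t ≤ (k + 1 : ℝ) → √t * |besselIntegral k t| ≤ 5 * 3 ^ k := by
    intro k hk
    have h1 : √t ≤ k + 1 := by
      rw [Real.sqrt_le_left (by positivity)]
      nlinarith [(Nat.cast_nonneg k : (0 : ℝ) ≤ k)]
    have h2 : (k : ℝ) + 1 ≤ 3 ^ k := by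
      have := one_add_mul_le_pow (show (-2 : ℝ) ≤ 2 by norm_num) k
      norm_num at this
      nlinarith [(Nat.cast_nonneg k : (0 : ℝ) ≤ k)]
    nlinarith [abs_le_one k t, abs_nonneg (besselIntegral k t), Real.sqrt_nonneg t]
  have hbase : ∀ x : ℝ, 1 ≤ t → t * x ^ 2 ≤ 18 → √t * |x| ≤ 5 := by
    intro x h1 hx
    refine abs_le_of_sq_le_sq' ?_ (by norm_num) |>.2
    rw [mul_pow, Real.sq_sqrt (by linarith), sq_abs]
    linarith
  induction n using Nat.strong_induction_on with
  | _ n ih =>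
    rcases le_total t (n + 1) with h | h
    · exact htriv n h
    · match n, ih, h with
      | 0, _, h =>
        have h1 : 1 ≤ t := by simpa using h
        have := sq_add_sq_le h1
        simpa using hbase _ h1 (by nlinarith [sq_nonneg (besselIntegral 1 t)])
      | 1, _, h =>
        have h1 : 1 ≤ t := by norm_num at h; linarith
        have := sq_add_sq_le h1
        have := hbase (besselIntegral 1 t) h1 (by nlinarith [sq_nonneg (besselIntegral 0 t)])
        simp only [Nat.cast_one]
        linarith
      | k + 2, ih, h =>
        have h1 := ih (k + 1) (by omega)
        have h2 := ih k (by omega)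
        push_cast at h h1 h2 ⊢
        have hk : (0 : ℝ) ≤ k := Nat.cast_nonneg k
        have ht : 0 < t := by linarith
        have hr := recurrence (k + 1) t
        have e : besselIntegral (k + 2) t
            = 2 * (k + 1) / t * besselIntegral (k + 1) t - besselIntegral k t := by
          rw [add_sub_cancel_right, add_assoc, one_add_one_eq_two] at hr
          push_cast at hr
          field_simp
          linarith
        have hc : 2 * (k + 1) / t ≤ 2 := by
          rw [div_le_iff₀ ht]; linarith
        have hc0 : 0 ≤ 2 * (k + 1) / t := by positivity
        have h3 : |besselIntegral (k + 2) t|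
            ≤ 2 * |besselIntegral (k + 1) t| + |besselIntegral k t| := by
          rw [e]
          refine (abs_sub _ _).trans ?_
          rw [abs_mul, abs_of_nonneg hc0]
          gcongr
        calc _ ≤ √t * (2 * |besselIntegral (k + 1) t| + |besselIntegral k t|) := by gcongr
          _ = 2 * (√t * |besselIntegral (k + 1) t|) + √t * |besselIntegral k t| := by ring
          _ ≤ 2 * (5 * 3 ^ (k + 1)) + 5 * 3 ^ k := by gcongr
          _ ≤ 5 * 3 ^ (k + 2) := by
            rw [pow_succ, pow_succ, pow_succ]
            nlinarith [pow_pos (show (0 : ℝ) < 3 by norm_num) k]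

/-! ### A common integrable majorant -/

/-- An integrable function on `(0, ∞)` dominating the integrands below. -/
noncomputable def majorant (t : ℝ) : ℝ := min (t ^ (-(3 / 4) : ℝ)) (t ^ (-(5 / 4) : ℝ))

theorem majorant_nonneg {t : ℝ} (ht : 0 < t) : 0 ≤ majorant t :=
  le_min (Real.rpow_nonneg ht.le _) (Real.rpow_nonneg ht.le _)

theorem integrableOn_majorant : IntegrableOn majorant (Set.Ioi 0) := by
  have hm : Measurable majorant := by unfold majorant; fun_prop
  rw [← Set.Ioc_union_Ioi_eq_Ioi (zero_le_one' ℝ)]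
  refine IntegrableOn.union ?_ ?_
  · have h : IntervalIntegrable (fun t : ℝ => t ^ (-(3 / 4) : ℝ)) volume 0 1 :=
      intervalIntegral.intervalIntegrable_rpow' (by norm_num)
    rw [intervalIntegrable_iff_integrableOn_Ioc_of_le zero_le_one] at h
    refine h.mono' hm.aestronglyMeasurable ?_
    filter_upwards [ae_restrict_mem measurableSet_Ioc] with t ht
    rw [Real.norm_of_nonneg (majorant_nonneg ht.1)]
    exact min_le_left _ _
  · refine (integrableOn_Ioi_rpow_of_lt (show (-(5 / 4) : ℝ) < -1 by norm_num) one_pos).mono'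
      hm.aestronglyMeasurable ?_
    filter_upwards [ae_restrict_mem measurableSet_Ioi] with t ht
    rw [Real.norm_of_nonneg (majorant_nonneg (zero_lt_one.trans ht))]
    exact min_le_right _ _

/-- The power t^(-3/4) is the size of the bound for Cin(t)/t. The bound |J_n| ≤ 1 serves near 0, and
the decay t^(-1/2) serves at infinity. -/
theorem rpow_mul_abs_le (n : ℕ) {t : ℝ} (ht : 0 < t) :
    t ^ (-(3 / 4) : ℝ) * |besselIntegral n t| ≤ 5 * 3 ^ n * majorant t := by
  have h3 : (1 : ℝ) ≤ 5 * 3 ^ n := by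
    have : (1 : ℝ) ≤ 3 ^ n := one_le_pow₀ (by norm_num)
    linarith
  have hp : 0 < t ^ (-(3 / 4) : ℝ) := Real.rpow_pos_of_pos ht _
  rw [majorant, mul_min_of_nonneg _ _ (by positivity)]
  refine le_min ?_ ?_
  · nlinarith [abs_le_one n t]
  · have e : t ^ (-(3 / 4) : ℝ) = t ^ (-(5 / 4) : ℝ) * √t := by
      rw [Real.sqrt_eq_rpow, ← Real.rpow_add ht]; norm_num
    rw [e, mul_assoc, mul_comm (5 * 3 ^ n : ℝ)]
    exact mul_le_mul_of_nonneg_left (sqrt_mul_abs_le n t) (Real.rpow_nonneg ht.le _)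

/-- The recurrence removes the division by t, which is why order 0 is excluded. -/
theorem abs_div_le_one {n : ℕ} (hn : n ≠ 0) (t : ℝ) : |besselIntegral n t / t| ≤ 1 := by
  have hr := recurrence n t
  have hn1 : (1 : ℝ) ≤ n := by exact_mod_cast Nat.one_le_iff_ne_zero.2 hn
  rcases eq_or_ne t 0 with rfl | ht
  · simp
  have a1 := abs_le_one (n - 1) t
  have a2 := abs_le_one (n + 1) t
  have e : besselIntegral n t / t
      = (besselIntegral (n - 1) t + besselIntegral (n + 1) t) / (2 * n) := by
    push_cast at hr
    field_simp
    linarith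
  rw [e, abs_div, abs_of_pos (by positivity : (0 : ℝ) < 2 * n), div_le_one (by positivity)]
  exact (abs_add_le _ _).trans (by linarith)

theorem abs_div_le_majorant {n : ℕ} (hn : n ≠ 0) {t : ℝ} (ht : 0 < t) :
    |besselIntegral n t / t| ≤ 5 * 3 ^ n * majorant t := by
  rcases le_total t 1 with h | h
  · have h3 : (1 : ℝ) ≤ 5 * 3 ^ n := by
      have : (1 : ℝ) ≤ 3 ^ n := one_le_pow₀ (by norm_num)
      linarith
    have : 1 ≤ majorant t :=
      le_min (Real.one_le_rpow_of_pos_of_le_one_of_nonpos ht h (by norm_num))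
        (Real.one_le_rpow_of_pos_of_le_one_of_nonpos ht h (by norm_num))
    nlinarith [abs_div_le_one hn t]
  · refine le_trans ?_ (rpow_mul_abs_le n ht)
    rw [abs_div, abs_of_pos ht, div_eq_inv_mul, ← Real.rpow_neg_one]
    exact mul_le_mul_of_nonneg_right (Real.rpow_le_rpow_of_exponent_le h (by norm_num))
      (abs_nonneg _)

theorem integrableOn_div {n : ℕ} (hn : n ≠ 0) :
    IntegrableOn (fun t => besselIntegral n t / t) (Set.Ioi 0) := by
  refine (integrableOn_majorant.const_mul (5 * 3 ^ n)).mono'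
    ((continuous n).measurable.div measurable_id).aestronglyMeasurable ?_
  filter_upwards [ae_restrict_mem measurableSet_Ioi] with t ht
  exact abs_div_le_majorant hn ht

theorem apply_zero_of_ne_zero {n : ℕ} (hn : n ≠ 0) : besselIntegral n 0 = 0 := by
  have h := recurrence n 0
  have : (n : ℝ) ≠ 0 := by exact_mod_cast hn
  simpa [this] using h

theorem zero_apply_zero : besselIntegral 0 0 = 1 := by
  have := Real.pi_ne_zero
  simp [besselIntegral]
  field_simp

/-! ### Laplace transform and its boundary values -/

/-- The Laplace transform of `J_n`. -/
noncomputable def laplace (n : ℤ) (p : ℂ) : ℂ :=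
  ∫ t in Set.Ioi (0 : ℝ), Complex.exp (-p * t) * (besselIntegral n t : ℂ)

theorem norm_exp_neg_mul (p : ℂ) (t : ℝ) :
    ‖Complex.exp (-p * t)‖ = Real.exp (-p.re * t) := by
  rw [Complex.norm_exp]; simp

theorem norm_laplace_integrand_le (n : ℤ) (p : ℂ) (t : ℝ) :
    ‖Complex.exp (-p * t) * (besselIntegral n t : ℂ)‖ ≤ Real.exp (-p.re * t) := by
  rw [norm_mul, norm_exp_neg_mul, Complex.norm_real]
  exact mul_le_of_le_one_right (Real.exp_pos _).le (abs_le_one n t)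

@[fun_prop]
theorem continuous_ofReal (n : ℤ) : Continuous fun t : ℝ => (besselIntegral n t : ℂ) :=
  Complex.continuous_ofReal.comp (continuous n)

theorem integrableOn_laplace (n : ℤ) {p : ℂ} (hp : 0 < p.re) :
    IntegrableOn (fun t : ℝ => Complex.exp (-p * t) * (besselIntegral n t : ℂ)) (Set.Ioi 0) :=
  (exp_neg_integrableOn_Ioi 0 hp).mono' (Continuous.aestronglyMeasurable (by fun_prop))
    (Filter.Eventually.of_forall fun t => norm_laplace_integrand_le n p t)

theorem norm_laplace_le (n : ℤ) {p : ℂ} (hp : 0 < p.re) :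
    ‖laplace n p‖ ≤ ∫ t in Set.Ioi (0 : ℝ), Real.exp (-p.re * t) :=
  norm_integral_le_of_norm_le (exp_neg_integrableOn_Ioi 0 hp)
    (Filter.Eventually.of_forall fun t => norm_laplace_integrand_le n p t)

/-- Integration by parts, with J_n' = (J_{n−1} − J_{n+1})/2. -/
theorem laplace_deriv (n : ℤ) {p : ℂ} (hp : 0 < p.re) :
    (laplace (n - 1) p - laplace (n + 1) p) / 2 - p * laplace n p = -besselIntegral n 0 := by
  have hd : ∀ t : ℝ, HasDerivAt (fun t : ℝ => Complex.exp (-p * t) * (besselIntegral n t : ℂ))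
      ((Complex.exp (-p * t) * (besselIntegral (n - 1) t : ℂ)
        - Complex.exp (-p * t) * (besselIntegral (n + 1) t : ℂ)) / 2
        - p * (Complex.exp (-p * t) * (besselIntegral n t : ℂ))) t := by
    intro t
    have h1 : HasDerivAt (fun t : ℝ => -p * (t : ℂ)) (-p) t := by
      simpa using (Complex.ofRealCLM.hasDerivAt (x := t)).const_mul (-p)
    refine (h1.cexp.mul (hasDerivAt n t).ofReal_comp).congr_deriv ?_
    push_cast
    ring
  have hi : IntegrableOn (fun t : ℝ => (Complex.exp (-p * t) * (besselIntegral (n - 1) t : ℂ)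
      - Complex.exp (-p * t) * (besselIntegral (n + 1) t : ℂ)) / 2) (Set.Ioi 0) :=
    ((integrableOn_laplace (n - 1) hp).sub (integrableOn_laplace (n + 1) hp)).div_const 2
  have hi2 := (integrableOn_laplace n hp).const_mul p
  have hlim : Filter.Tendsto (fun t : ℝ => Complex.exp (-p * t) * (besselIntegral n t : ℂ))
      Filter.atTop (nhds 0) := by
    refine squeeze_zero_norm (norm_laplace_integrand_le n p) ?_
    refine Real.tendsto_exp_atBot.comp ?_
    exact Filter.tendsto_id.const_mul_atTop_of_neg (by linarith)
  have h := integral_Ioi_of_hasDerivAt_of_tendsto' (fun t _ => hd t) (hi.sub hi2) hlim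
  rw [integral_sub hi hi2, integral_div, integral_sub (integrableOn_laplace _ hp)
    (integrableOn_laplace _ hp), integral_const_mul] at h
  simpa [laplace] using h

theorem laplace_recurrence {n : ℕ} (hn : n ≠ 0) {p : ℂ} (hp : 0 < p.re) :
    laplace (n + 1) p = laplace (n - 1) p - 2 * p * laplace n p := by
  have h := laplace_deriv n hp
  rw [apply_zero_of_ne_zero hn] at h
  push_cast at h
  linear_combination (-2 : ℂ) * h

theorem laplace_one {p : ℂ} (hp : 0 < p.re) : laplace 1 p = 1 - p * laplace 0 p := by
  have h := laplace_deriv 0 hp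
  have hneg : laplace (-1) p = -laplace 1 p := by
    rw [laplace, laplace, ← integral_neg]
    congr 1
    ext t
    rw [neg_order 1 t]
    push_cast
    ring
  rw [zero_apply_zero, zero_sub, zero_add, hneg] at h
  push_cast at h
  linear_combination -h

/-- For p = (1/x − x)/2 the recurrence in n has characteristic roots x and −1/x. The difference `d`
removes the first mode, so d_n = (−x)^k d_{n+k} for every k; as `d` is bounded and |x| < 1, it
vanishes. -/
theorem laplace_succ {x : ℂ} (hx0 : x ≠ 0) (hx : ‖x‖ < 1) (hp : 0 < ((x⁻¹ - x) / 2).re) (n : ℕ) :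
    laplace (n + 1) ((x⁻¹ - x) / 2) = x * laplace n ((x⁻¹ - x) / 2) := by
  set p := (x⁻¹ - x) / 2 with hpx
  set d : ℕ → ℂ := fun n => laplace (n + 1) p - x * laplace n p with hd
  have hstep : ∀ n, x * d (n + 1) = -d n := by
    intro n
    have h := laplace_recurrence (Nat.succ_ne_zero n) hp
    simp only [hd]
    push_cast at h ⊢
    rw [add_sub_cancel_right] at h
    have h2 : 2 * p * x = 1 - x ^ 2 := by rw [hpx]; field_simp
    linear_combination x * h - laplace (n + 1) p * h2
  have hpow : ∀ k n, ‖d n‖ = ‖x‖ ^ k * ‖d (n + k)‖ := by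
    intro k
    induction k with
    | zero => simp
    | succ k ih =>
      intro n
      have := congrArg norm (hstep (n + k))
      rw [norm_neg, norm_mul] at this
      rw [ih n, ← this, ← add_assoc]
      ring
  set B := ∫ t in Set.Ioi (0 : ℝ), Real.exp (-p.re * t)
  have hb : ∀ n, ‖d n‖ ≤ B + B := by
    intro n
    refine (norm_sub_le _ _).trans (add_le_add (norm_laplace_le _ hp) ?_)
    rw [norm_mul]
    exact (mul_le_of_le_one_left (norm_nonneg _) hx.le).trans (norm_laplace_le _ hp)
  have hlim : Filter.Tendsto (fun k : ℕ => ‖x‖ ^ k * (B + B)) Filter.atTop (nhds 0) := by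
    simpa using (tendsto_pow_atTop_nhds_zero_of_lt_one (norm_nonneg x) hx).mul_const (B + B)
  have h0 : ‖d n‖ ≤ 0 := by
    refine ge_of_tendsto hlim (Filter.Eventually.of_forall fun k => ?_)
    rw [hpow k n]
    exact mul_le_mul_of_nonneg_left (hb _) (by positivity)
  exact sub_eq_zero.1 (norm_le_zero_iff.1 h0)

theorem laplace_eq_pow_mul {x : ℂ} (hx0 : x ≠ 0) (hx : ‖x‖ < 1)
    (hp : 0 < ((x⁻¹ - x) / 2).re) (n : ℕ) :
    laplace n ((x⁻¹ - x) / 2) = x ^ n * laplace 0 ((x⁻¹ - x) / 2) := by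
  induction n with
  | zero => simp
  | succ n ih =>
    push_cast
    rw [laplace_succ hx0 hx hp, ih]
    ring

/-- The recurrence turns J_n/t into (J_{n−1} + J_{n+1})/(2n). The transform L₀ of J₀ comes from L₁ =
xL₀ = 1 − pL₀, that is, L₀·(p + x) = 1. -/
theorem integral_exp_mul_div {x : ℂ} (hx0 : x ≠ 0) (hx : ‖x‖ < 1)
    (hp : 0 < ((x⁻¹ - x) / 2).re) {n : ℕ} (hn : n ≠ 0) :
    ∫ t in Set.Ioi (0 : ℝ), Complex.exp (-((x⁻¹ - x) / 2) * t)
      * ((besselIntegral n t / t : ℝ) : ℂ) = x ^ n / n := by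
  obtain ⟨k, rfl⟩ := Nat.exists_eq_succ_of_ne_zero hn
  set p := (x⁻¹ - x) / 2 with hpx
  have hk : ((k : ℂ) + 1) ≠ 0 := by exact_mod_cast Nat.succ_ne_zero k
  have hkr : ((k : ℝ) + 1) ≠ 0 := by exact_mod_cast Nat.succ_ne_zero k
  have h1 : ∫ t in Set.Ioi (0 : ℝ), Complex.exp (-p * t)
      * ((besselIntegral (k + 1 : ℕ) t / t : ℝ) : ℂ)
      = ∫ t in Set.Ioi (0 : ℝ), (Complex.exp (-p * t) * (besselIntegral k t : ℂ)
        + Complex.exp (-p * t) * (besselIntegral (k + 2 : ℕ) t : ℂ)) / (2 * (k + 1)) := by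
    refine setIntegral_congr_fun measurableSet_Ioi fun t ht => ?_
    have ht0 : t ≠ 0 := ne_of_gt ht
    have hr := recurrence (k + 1) t
    rw [add_sub_cancel_right, add_assoc, one_add_one_eq_two] at hr
    push_cast at hr
    have e : besselIntegral (k + 1) t / t
        = (besselIntegral k t + besselIntegral (k + 2) t) / (2 * (k + 1)) := by
      field_simp
      linarith
    push_cast
    rw [← Complex.ofReal_div, e]
    push_cast
    ring
  have h2 := laplace_one hp
  have h3 := laplace_eq_pow_mul hx0 hx hp 1
  have h4 := laplace_eq_pow_mul hx0 hx hp k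
  have h5 := laplace_eq_pow_mul hx0 hx hp (k + 2)
  simp only [Nat.cast_one, pow_one] at h3
  rw [h1, integral_div, integral_add (integrableOn_laplace _ hp) (integrableOn_laplace _ hp)]
  change (laplace k p + laplace (k + 2 : ℕ) p) / _ = _
  rw [h4, h5]
  have h6 : x * (p + x) = (1 + x ^ 2) / 2 := by rw [hpx]; field_simp; ring
  have h7 : laplace 0 p * (p + x) = 1 := by linear_combination -h3 + h2
  push_cast
  rw [Nat.succ_eq_add_one, div_eq_div_iff (by simpa using hk) hk]
  linear_combination (x ^ k * laplace 0 p * (k + 1)) * (-2) * h6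
    + 2 * (k + 1) * x ^ (k + 1) * h7

/-- Take x = re^{iφ} and let r increase to 1: p tends to −i sin φ, and Re p = (1/r − r) cos φ / 2
stays positive, so |J_n(t)/t| dominates. -/
theorem integral_exp_sin_mul_div {φ : ℝ} (hφ : 0 < Real.cos φ) {n : ℕ} (hn : n ≠ 0) :
    ∫ t in Set.Ioi (0 : ℝ), Complex.exp ((t * Real.sin φ : ℝ) * Complex.I)
      * ((besselIntegral n t / t : ℝ) : ℂ) = Complex.exp ((n * φ : ℝ) * Complex.I) / n := by
  set w : ℂ := Complex.exp (φ * Complex.I) with hw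
  have hw0 : w ≠ 0 := Complex.exp_ne_zero _
  have hwi : w⁻¹ = Complex.exp (((-φ : ℝ) : ℂ) * Complex.I) := by
    rw [hw, ← Complex.exp_neg]; push_cast; ring_nf
  have hre : ∀ r : ℝ, ((((r : ℂ) * w)⁻¹ - r * w) / 2).re = (r⁻¹ - r) * Real.cos φ / 2 := by
    intro r
    rw [mul_inv, hwi, ← Complex.ofReal_inv, Complex.div_ofNat_re, Complex.sub_re,
      Complex.re_ofReal_mul, Complex.re_ofReal_mul, hw, Complex.exp_ofReal_mul_I_re,
      Complex.exp_ofReal_mul_I_re, Real.cos_neg]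
    ring
  have hnear : ∀ᶠ r : ℝ in nhdsWithin 1 (Set.Iio 1), 0 < r ∧ r < 1 := by
    filter_upwards [self_mem_nhdsWithin, mem_nhdsWithin_of_mem_nhds (lt_mem_nhds one_pos)]
      with r h1 h2 using ⟨h2, h1⟩
  have hpos : ∀ r : ℝ, 0 < r → r < 1 → 0 < ((((r : ℂ) * w)⁻¹ - r * w) / 2).re := by
    intro r h0 h1
    rw [hre]
    have : 1 < r⁻¹ := (one_lt_inv₀ h0).2 h1
    have : 0 < r⁻¹ - r := by linarith
    positivity
  have hmeas : Measurable fun t : ℝ => ((besselIntegral n t / t : ℝ) : ℂ) :=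
    Complex.measurable_ofReal.comp ((continuous n).measurable.div measurable_id)
  have hlim : Filter.Tendsto (fun r : ℝ => ∫ t in Set.Ioi (0 : ℝ),
      Complex.exp (-((((r : ℂ) * w)⁻¹ - r * w) / 2) * t)
      * ((besselIntegral n t / t : ℝ) : ℂ)) (nhdsWithin 1 (Set.Iio 1))
      (nhds (∫ t in Set.Ioi (0 : ℝ), Complex.exp ((t * Real.sin φ : ℝ) * Complex.I)
      * ((besselIntegral n t / t : ℝ) : ℂ))) := by
    refine tendsto_integral_filter_of_dominated_convergence
      (fun t => ‖besselIntegral n t / t‖) ?_ ?_ (integrableOn_div hn).norm ?_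
    · refine Filter.Eventually.of_forall fun r => AEStronglyMeasurable.mul ?_
        hmeas.aestronglyMeasurable
      exact Continuous.aestronglyMeasurable (by fun_prop)
    · filter_upwards [hnear] with r hr
      filter_upwards [ae_restrict_mem measurableSet_Ioi] with t ht
      rw [norm_mul, norm_exp_neg_mul, Complex.norm_real]
      refine mul_le_of_le_one_left (norm_nonneg _) (Real.exp_le_one_iff.2 ?_)
      have := mul_pos (hpos r hr.1 hr.2) ht
      linarith
    · refine Filter.Eventually.of_forall fun t => Filter.Tendsto.mul_const _ ?_
      have hc : ContinuousAt
          (fun r : ℝ => Complex.exp (-((((r : ℂ) * w)⁻¹ - r * w) / 2) * t)) 1 := by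
        have : ContinuousAt (fun r : ℝ => ((r : ℂ) * w)⁻¹) 1 :=
          ContinuousAt.inv₀ (by fun_prop) (by simpa using hw0)
        fun_prop
      have e : Complex.exp ((t * Real.sin φ : ℝ) * Complex.I)
          = Complex.exp (-(((((1 : ℝ) : ℂ) * w)⁻¹ - ((1 : ℝ) : ℂ) * w) / 2) * t) := by
        congr 1
        rw [Complex.ofReal_one, one_mul, hwi, hw]
        push_cast
        rw [Complex.sin]
        linear_combination (t / 2 * (Complex.exp (-φ * Complex.I) - Complex.exp (φ * Complex.I)))
          * Complex.I_sq
      rw [e]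
      exact hc.tendsto.mono_left nhdsWithin_le_nhds
  have hlim2 : Filter.Tendsto (fun r : ℝ => ((r : ℂ) * w) ^ n / n) (nhdsWithin 1 (Set.Iio 1))
      (nhds (Complex.exp ((n * φ : ℝ) * Complex.I) / n)) := by
    have hc : ContinuousAt (fun r : ℝ => ((r : ℂ) * w) ^ n / n) 1 := by fun_prop
    have e : Complex.exp ((n * φ : ℝ) * Complex.I) / n = (((1 : ℝ) : ℂ) * w) ^ n / n := by
      rw [Complex.ofReal_one, one_mul, hw, ← Complex.exp_nat_mul]
      push_cast
      ring_nf
    rw [e]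
    exact hc.tendsto.mono_left nhdsWithin_le_nhds
  refine tendsto_nhds_unique hlim (hlim2.congr' ?_)
  filter_upwards [hnear] with r hr
  refine (integral_exp_mul_div (mul_ne_zero (by exact_mod_cast hr.1.ne') hw0) ?_
    (hpos r hr.1 hr.2) hn).symm
  rw [norm_mul, hw, Complex.norm_exp_ofReal_mul_I, mul_one, Complex.norm_real,
    Real.norm_of_nonneg hr.1.le]
  exact hr.2

theorem integrableOn_exp_sin_mul_div (s : ℝ) {n : ℕ} (hn : n ≠ 0) :
    IntegrableOn (fun t : ℝ => Complex.exp ((t * s : ℝ) * Complex.I)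
      * ((besselIntegral n t / t : ℝ) : ℂ)) (Set.Ioi 0) := by
  refine (integrableOn_div hn).norm.mono' (AEStronglyMeasurable.mul
    (Continuous.aestronglyMeasurable (by fun_prop))
    (Complex.measurable_ofReal.comp
      ((continuous n).measurable.div measurable_id)).aestronglyMeasurable) ?_
  refine Filter.Eventually.of_forall fun t => ?_
  rw [norm_mul, Complex.norm_exp_ofReal_mul_I, one_mul, Complex.norm_real]

theorem integral_cos_mul_div {φ : ℝ} (hφ : 0 < Real.cos φ) {n : ℕ} (hn : n ≠ 0) :
    ∫ t in Set.Ioi (0 : ℝ), Real.cos (t * Real.sin φ) * (besselIntegral n t / t)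
      = Real.cos (n * φ) / n := by
  have h := congrArg Complex.re (integral_exp_sin_mul_div hφ hn)
  have h2 := integral_re (integrableOn_exp_sin_mul_div (Real.sin φ) hn)
  simp only [RCLike.re_to_complex] at h2
  rw [← h2] at h
  simpa only [Complex.re_mul_ofReal, Complex.exp_ofReal_mul_I_re, Complex.div_natCast_re] using h

theorem integral_sin_mul_div {φ : ℝ} (hφ : 0 < Real.cos φ) {n : ℕ} (hn : n ≠ 0) :
    ∫ t in Set.Ioi (0 : ℝ), Real.sin (t * Real.sin φ) * (besselIntegral n t / t)
      = Real.sin (n * φ) / n := by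
  have h := congrArg Complex.im (integral_exp_sin_mul_div hφ hn)
  have h2 := integral_im (integrableOn_exp_sin_mul_div (Real.sin φ) hn)
  simp only [RCLike.im_to_complex] at h2
  rw [← h2] at h
  simpa only [Complex.im_mul_ofReal, Complex.exp_ofReal_mul_I_im, Complex.div_natCast_im] using h

end besselIntegral

/-! ### The entire cosine integral -/

/-- The entire cosine integral `Cin(t) = ∫_0^t (1 - cos u) / u du`. -/
noncomputable def cosIntegralEntire (t : ℝ) : ℝ := ∫ u in (0 : ℝ)..t, (1 - Real.cos u) / u

theorem eulerMascheroni_add_log_sub_cosIntegral (t : ℝ) :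
    Real.eulerMascheroniConstant + Real.log t - cosIntegral t = cosIntegralEntire t := by
  have h : ∀ u : ℝ, (1 - Real.cos u) / u = -((Real.cos u - 1) / u) := by intro u; ring
  simp_rw [cosIntegralEntire, h]
  rw [intervalIntegral.integral_neg, cosIntegral]
  ring

theorem continuous_one_sub_cos_div : Continuous fun u : ℝ => (1 - Real.cos u) / u := by
  have h : (fun u : ℝ => (1 - Real.cos u) / u) = fun u => Real.sin (u / 2) * Real.sinc (u / 2) := by
    ext u
    rcases eq_or_ne u 0 with rfl | hu
    · simp
    · have e : Real.cos u = 1 - 2 * Real.sin (u / 2) ^ 2 := by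
        have := Real.cos_two_mul' (u / 2)
        rw [mul_div_cancel₀ u two_ne_zero] at this
        linarith [Real.sin_sq_add_cos_sq (u / 2)]
      rw [Real.sinc_of_ne_zero (by simpa using hu), e]
      field_simp
      ring
  rw [h]
  exact (Real.continuous_sin.comp (by fun_prop)).mul (Real.continuous_sinc.comp (by fun_prop))

theorem continuous_cosIntegralEntire : Continuous cosIntegralEntire :=
  intervalIntegral.continuous_primitive
    (fun _ _ => continuous_one_sub_cos_div.intervalIntegrable _ _) 0

/-- Any exponent strictly between 0 and 1/2 would serve: positive for integrability at 0, below 1/2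
so that the decay t^(-1/2) of the Bessel function wins at infinity. -/
theorem one_sub_cos_le_rpow {u : ℝ} (hu : 0 < u) :
    1 - Real.cos u ≤ 2 * u ^ (1 / 4 : ℝ) := by
  rcases le_total u 1 with h | h
  · have h1 : u ≤ u ^ (1 / 4 : ℝ) := by
      simpa using Real.rpow_le_rpow_of_exponent_ge hu h (show (1 / 4 : ℝ) ≤ 1 by norm_num)
    have h2 := Real.one_sub_sq_div_two_le_cos (x := u)
    nlinarith
  · have h1 : 1 ≤ u ^ (1 / 4 : ℝ) := Real.one_le_rpow h (by norm_num)
    linarith [Real.neg_one_le_cos u]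

theorem abs_cosIntegralEntire_le {t : ℝ} (ht : 0 < t) :
    |cosIntegralEntire t| ≤ 8 * t ^ (1 / 4 : ℝ) := by
  have hi : IntervalIntegrable (fun u : ℝ => 2 * u ^ (-(3 / 4) : ℝ)) volume 0 t :=
    (intervalIntegral.intervalIntegrable_rpow' (by norm_num)).const_mul 2
  have h := intervalIntegral.norm_integral_le_of_norm_le ht.le
    (f := fun u => (1 - Real.cos u) / u) (Filter.Eventually.of_forall fun u hu => ?_) hi
  · rw [intervalIntegral.integral_const_mul, integral_rpow (Or.inl (by norm_num))] at h
    refine h.trans (le_of_eq ?_)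
    norm_num
    ring
  · have hu0 : 0 < u := hu.1
    rw [Real.norm_of_nonneg (div_nonneg (by linarith [Real.cos_le_one u]) hu0.le),
      div_le_iff₀ hu0, mul_assoc]
    have e : u ^ (-(3 / 4) : ℝ) * u = u ^ (1 / 4 : ℝ) := by
      nth_rewrite 2 [← Real.rpow_one u]
      rw [← Real.rpow_add hu0]; norm_num
    rw [e]
    exact one_sub_cos_le_rpow hu0

theorem cosIntegralEntire_eq_integral_cot (t : ℝ) :
    cosIntegralEntire t = ∫ φ in (0 : ℝ)..Real.pi / 2,
      (1 - Real.cos (t * Real.sin φ)) * (Real.cos φ / Real.sin φ) := by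
  have h := intervalIntegral.integral_comp_mul_deriv (a := 0) (b := Real.pi / 2)
    (f := fun φ => t * Real.sin φ) (f' := fun φ => t * Real.cos φ)
    (fun φ _ => (Real.hasDerivAt_sin φ).const_mul t) (by fun_prop) continuous_one_sub_cos_div
  simp only [Real.sin_zero, mul_zero, Real.sin_pi_div_two, mul_one] at h
  rw [cosIntegralEntire, ← h]
  congr 1
  ext φ
  simp only [Function.comp]
  rcases eq_or_ne t 0 with rfl | ht
  · simp
  · rcases eq_or_ne (Real.sin φ) 0 with h0 | h0
    · simp [h0]
    · field_simp

/-! ### Integrals of Cin(t) J_n(t) / t -/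

namespace besselIntegral

theorem abs_cosIntegralEntire_mul_div_le (n : ℕ) {t : ℝ} (ht : 0 < t) :
    |cosIntegralEntire t * besselIntegral n t / t| ≤ 40 * 3 ^ n * majorant t := by
  have e : t ^ (1 / 4 : ℝ) / t = t ^ (-(3 / 4) : ℝ) := by
    nth_rewrite 2 [← Real.rpow_one t]
    rw [← Real.rpow_sub ht]; norm_num
  calc |cosIntegralEntire t * besselIntegral n t / t|
      = |cosIntegralEntire t| * |besselIntegral n t| / t := by
        rw [abs_div, abs_mul, abs_of_pos ht]
    _ ≤ 8 * t ^ (1 / 4 : ℝ) * |besselIntegral n t| / t := by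
        gcongr
        exact abs_cosIntegralEntire_le ht
    _ = 8 * (t ^ (-(3 / 4) : ℝ) * |besselIntegral n t|) := by rw [← e]; ring
    _ ≤ 8 * (5 * 3 ^ n * majorant t) :=
        mul_le_mul_of_nonneg_left (rpow_mul_abs_le n ht) (by norm_num)
    _ = _ := by ring

theorem integrableOn_cosIntegralEntire_mul_div (n : ℕ) :
    IntegrableOn (fun t => cosIntegralEntire t * besselIntegral n t / t) (Set.Ioi 0) := by
  refine (integrableOn_majorant.const_mul (40 * 3 ^ n)).mono'
    ((continuous_cosIntegralEntire.mul (continuous n)).measurable.div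
      measurable_id).aestronglyMeasurable ?_
  filter_upwards [ae_restrict_mem measurableSet_Ioi] with t ht
  exact abs_cosIntegralEntire_mul_div_le n ht

/-- The power bound on 1 − cos(t sin φ) separates t from φ; Jordan's inequality sin φ ≥ 2φ/π then
gives φ^(-3/4), integrable at 0. -/
theorem integrable_kernel (n : ℕ) :
    Integrable (Function.uncurry fun t φ : ℝ =>
      (1 - Real.cos (t * Real.sin φ)) * (Real.cos φ / Real.sin φ) * (besselIntegral n t / t))
      ((volume.restrict (Set.Ioi 0)).prod (volume.restrict (Set.Ioc 0 (Real.pi / 2)))) := by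
  have hp := Real.pi_pos
  have hi : IntegrableOn (fun φ : ℝ => 2 * (2 / Real.pi) ^ (-(3 / 4) : ℝ) * φ ^ (-(3 / 4) : ℝ))
      (Set.Ioc 0 (Real.pi / 2)) := by
    rw [← intervalIntegrable_iff_integrableOn_Ioc_of_le (by positivity)]
    exact (intervalIntegral.intervalIntegrable_rpow' (by norm_num)).const_mul _
  have hJ := (integrableOn_majorant.const_mul (5 * 3 ^ n)).mul_prod hi
  refine hJ.mono' ?_ ?_
  · have := (continuous n).measurable
    exact Measurable.aestronglyMeasurable (by unfold Function.uncurry; fun_prop)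
  · rw [Measure.prod_restrict]
    filter_upwards [ae_restrict_mem (measurableSet_Ioi.prod measurableSet_Ioc)] with ⟨t, φ⟩ h
    obtain ⟨ht, hφ0, hφ1⟩ := h
    simp only [Set.mem_Ioi] at ht
    simp only [Function.uncurry] at hφ0 hφ1 ⊢
    have hs1 : 2 / Real.pi * φ ≤ Real.sin φ := Real.mul_le_sin hφ0.le hφ1
    have hs2 : 0 < 2 / Real.pi * φ := by positivity
    have hs : 0 < Real.sin φ := hs2.trans_le hs1
    have h1 : 0 ≤ 1 - Real.cos (t * Real.sin φ) := by linarith [Real.cos_le_one (t * Real.sin φ)]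
    have h2 := one_sub_cos_le_rpow (mul_pos ht hs)
    rw [Real.mul_rpow ht.le hs.le] at h2
    have e1 : t ^ (1 / 4 : ℝ) / t = t ^ (-(3 / 4) : ℝ) := by
      nth_rewrite 2 [← Real.rpow_one t]
      rw [← Real.rpow_sub ht]; norm_num
    have e2 : Real.sin φ ^ (1 / 4 : ℝ) / Real.sin φ = Real.sin φ ^ (-(3 / 4) : ℝ) := by
      nth_rewrite 2 [← Real.rpow_one (Real.sin φ)]
      rw [← Real.rpow_sub hs]; norm_num
    have h3 : Real.sin φ ^ (-(3 / 4) : ℝ)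
        ≤ (2 / Real.pi) ^ (-(3 / 4) : ℝ) * φ ^ (-(3 / 4) : ℝ) := by
      rw [← Real.mul_rpow (by positivity) hφ0.le]
      exact Real.rpow_le_rpow_of_nonpos hs2 hs1 (by norm_num)
    have h4 := rpow_mul_abs_le n ht
    rw [norm_mul, norm_mul, Real.norm_of_nonneg h1, norm_div, norm_div, Real.norm_of_nonneg hs.le,
      Real.norm_of_nonneg ht.le, Real.norm_eq_abs, Real.norm_eq_abs]
    calc _ ≤ 2 * (t ^ (1 / 4 : ℝ) * Real.sin φ ^ (1 / 4 : ℝ)) * (1 / Real.sin φ)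
          * (|besselIntegral n t| / t) := by
          gcongr
          exact Real.abs_cos_le_one φ
      _ = 2 * Real.sin φ ^ (-(3 / 4) : ℝ) * (t ^ (-(3 / 4) : ℝ) * |besselIntegral n t|) := by
          rw [← e1, ← e2]; ring
      _ ≤ 2 * ((2 / Real.pi) ^ (-(3 / 4) : ℝ) * φ ^ (-(3 / 4) : ℝ)) * (5 * 3 ^ n * majorant t) := by
          gcongr
      _ = _ := by ring

theorem integral_cosIntegralEntire_eq (n : ℕ) :
    ∫ t in Set.Ioi (0 : ℝ), cosIntegralEntire t * besselIntegral n t / t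
      = ∫ φ in (0 : ℝ)..Real.pi / 2, (Real.cos φ / Real.sin φ)
        * ∫ t in Set.Ioi (0 : ℝ), (1 - Real.cos (t * Real.sin φ)) * (besselIntegral n t / t) := by
  have h := integral_integral_swap (integrable_kernel n)
  have hp : (0 : ℝ) ≤ Real.pi / 2 := by positivity
  calc _ = ∫ t in Set.Ioi (0 : ℝ), ∫ φ in Set.Ioc 0 (Real.pi / 2),
      (1 - Real.cos (t * Real.sin φ)) * (Real.cos φ / Real.sin φ) * (besselIntegral n t / t) := by
        congr 1
        ext t
        rw [integral_mul_const, ← intervalIntegral.integral_of_le hp,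
          ← cosIntegralEntire_eq_integral_cot]
        ring
    _ = _ := by
        rw [h, intervalIntegral.integral_of_le hp]
        congr 1
        ext φ
        rw [← integral_const_mul]
        congr 1
        ext t
        ring

theorem integrableOn_cos_mul_div (s : ℝ) {n : ℕ} (hn : n ≠ 0) :
    IntegrableOn (fun t => Real.cos (t * s) * (besselIntegral n t / t)) (Set.Ioi 0) := by
  refine (integrableOn_div hn).norm.mono' ((Continuous.aestronglyMeasurable (by fun_prop)).mul
    ((continuous n).measurable.div measurable_id).aestronglyMeasurable)
    (Filter.Eventually.of_forall fun t => ?_)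
  rw [norm_mul]
  exact mul_le_of_le_one_left (norm_nonneg _) (Real.abs_cos_le_one _)

theorem integral_one_sub_cos_mul_div {φ : ℝ} (hφ : 0 < Real.cos φ) {n : ℕ} (hn : n ≠ 0) :
    ∫ t in Set.Ioi (0 : ℝ), (1 - Real.cos (t * Real.sin φ)) * (besselIntegral n t / t)
      = (1 - Real.cos (n * φ)) / n := by
  have h0 := integral_cos_mul_div (φ := 0) (by simp) hn
  simp only [Real.sin_zero, mul_zero, Real.cos_zero, one_mul] at h0
  simp_rw [sub_mul, one_mul]
  rw [integral_sub (integrableOn_div hn) (integrableOn_cos_mul_div _ hn), h0,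
    integral_cos_mul_div hφ hn]
  ring

theorem integrable_sin_kernel (s : ℝ) :
    Integrable (Function.uncurry fun t u : ℝ => Real.sin (t * u) * (besselIntegral 1 t / t))
      ((volume.restrict (Set.Ioi 0)).prod (volume.restrict (Set.Ioc 0 s))) := by
  have h1 : Integrable (fun _ : ℝ => (1 : ℝ)) (volume.restrict (Set.Ioc 0 s)) :=
    integrable_const 1
  have hJ := (integrableOn_div one_ne_zero).norm.mul_prod h1
  refine hJ.mono' ?_ (Filter.Eventually.of_forall fun p => ?_)
  · have := (continuous 1).measurable
    exact Measurable.aestronglyMeasurable (by unfold Function.uncurry; fun_prop)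
  · simp only [Function.uncurry, Nat.cast_one, mul_one]
    rw [norm_mul]
    exact mul_le_of_le_one_left (norm_nonneg _) (Real.abs_sin_le_one _)

theorem integral_sin_mul_const {t : ℝ} (ht : t ≠ 0) {s : ℝ} (hs : 0 ≤ s) (c : ℝ) :
    ∫ u in Set.Ioc 0 s, Real.sin (t * u) * c = (1 - Real.cos (t * s)) / t * c := by
  rw [integral_mul_const, ← intervalIntegral.integral_of_le hs,
    intervalIntegral.integral_comp_mul_left _ ht, integral_sin, mul_zero, Real.cos_zero,
    smul_eq_mul]
  ring

/-- Since (1 − cos(ts))/t = ∫₀ˢ sin(tu) du, Fubini reduces this to the sine formula of order 1 at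
angle arcsin u, whose value is u. -/
theorem integral_one_sub_cos_mul_div_sq {φ : ℝ} (hφ0 : 0 ≤ φ) (hφ : φ < Real.pi / 2) :
    ∫ t in Set.Ioi (0 : ℝ), (1 - Real.cos (t * Real.sin φ)) / t * (besselIntegral 1 t / t)
      = Real.sin φ ^ 2 / 2 := by
  have hs : 0 ≤ Real.sin φ := Real.sin_nonneg_of_nonneg_of_le_pi hφ0 (by linarith [Real.pi_pos])
  have hlt : Real.sin φ < 1 := by
    rw [← Real.sin_pi_div_two]
    exact Real.sin_lt_sin_of_lt_of_le_pi_div_two (by linarith) le_rfl hφ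
  have h := integral_integral_swap (integrable_sin_kernel (Real.sin φ))
  calc _ = ∫ t in Set.Ioi (0 : ℝ), ∫ u in Set.Ioc 0 (Real.sin φ),
        Real.sin (t * u) * (besselIntegral 1 t / t) :=
        setIntegral_congr_fun measurableSet_Ioi fun t ht =>
          (integral_sin_mul_const (ne_of_gt ht) hs _).symm
    _ = ∫ u in Set.Ioc 0 (Real.sin φ), u := by
        rw [h]
        refine setIntegral_congr_fun measurableSet_Ioc fun u hu => ?_
        have hu1 : u < 1 := hu.2.trans_lt hlt
        have hu0 : -1 < u := by linarith [hu.1]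
        have hc : 0 < Real.cos (Real.arcsin u) := Real.cos_pos_of_mem_Ioo
          ⟨Real.neg_pi_div_two_lt_arcsin.2 hu0, Real.arcsin_lt_pi_div_two.2 hu1⟩
        have := integral_sin_mul_div hc one_ne_zero
        simpa [Real.sin_arcsin hu0.le hu1.le] using this
    _ = _ := by
        rw [← intervalIntegral.integral_of_le hs, integral_id]
        ring

theorem integrableOn_one_sub_cos_mul_div_sq {s : ℝ} (hs : 0 ≤ s) :
    IntegrableOn (fun t => (1 - Real.cos (t * s)) / t * (besselIntegral 1 t / t))
      (Set.Ioi 0) := by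
  refine Integrable.congr (integrable_sin_kernel s).integral_prod_left ?_
  filter_upwards [ae_restrict_mem measurableSet_Ioi] with t ht
  exact integral_sin_mul_const (ne_of_gt ht) hs (besselIntegral 1 t / t)

/-- J₀(t)/t is not integrable at 0, so the formula for n ≥ 1 has no direct analogue. Writing J₀ =
2J₁/t − J₂ gives sin²φ − (1 − cos 2φ)/2 = 0. -/
theorem integral_one_sub_cos_mul_zero_div {φ : ℝ} (hφ0 : 0 ≤ φ) (hφ : φ < Real.pi / 2) :
    ∫ t in Set.Ioi (0 : ℝ), (1 - Real.cos (t * Real.sin φ)) * (besselIntegral 0 t / t) = 0 := by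
  have hs : 0 ≤ Real.sin φ := Real.sin_nonneg_of_nonneg_of_le_pi hφ0 (by linarith [Real.pi_pos])
  have hc : 0 < Real.cos φ := Real.cos_pos_of_mem_Ioo ⟨by linarith, hφ⟩
  have h1 := integral_one_sub_cos_mul_div_sq hφ0 hφ
  have h2 := integral_one_sub_cos_mul_div hc two_ne_zero
  have i1 := (integrableOn_one_sub_cos_mul_div_sq hs).const_mul 2
  have i2 : IntegrableOn
      (fun t => (1 - Real.cos (t * Real.sin φ)) * (besselIntegral (2 : ℕ) t / t)) (Set.Ioi 0) := by
    simp_rw [sub_mul, one_mul]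
    exact (integrableOn_div two_ne_zero).sub (integrableOn_cos_mul_div _ two_ne_zero)
  have e : ∫ t in Set.Ioi (0 : ℝ), (1 - Real.cos (t * Real.sin φ)) * (besselIntegral 0 t / t)
      = ∫ t in Set.Ioi (0 : ℝ),
        (2 * ((1 - Real.cos (t * Real.sin φ)) / t * (besselIntegral 1 t / t))
          - (1 - Real.cos (t * Real.sin φ)) * (besselIntegral (2 : ℕ) t / t)) := by
    refine setIntegral_congr_fun measurableSet_Ioi fun t ht => ?_
    have ht0 : t ≠ 0 := ne_of_gt ht
    have hr := recurrence 1 t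
    norm_num at hr
    have hr' : besselIntegral 0 t = 2 * besselIntegral 1 t / t - besselIntegral 2 t := by
      field_simp; linarith
    simp only [hr', Nat.cast_ofNat]
    field_simp
  rw [e, integral_sub i1 i2, integral_const_mul, h1, h2]
  push_cast
  rw [Real.cos_two_mul, Real.cos_sq']
  ring

theorem integral_cosIntegralEntire_zero :
    ∫ t in Set.Ioi (0 : ℝ), cosIntegralEntire t * besselIntegral 0 t / t = 0 := by
  have h := integral_cosIntegralEntire_eq 0
  rw [Nat.cast_zero] at h
  have hp : (0 : ℝ) ≤ Real.pi / 2 := by positivity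
  -- The endpoint π/2 is dropped because the inner formula requires cos φ > 0.
  rw [h, intervalIntegral.integral_of_le hp, integral_Ioc_eq_integral_Ioo]
  refine setIntegral_eq_zero_of_forall_eq_zero fun φ hφ => ?_
  rw [integral_one_sub_cos_mul_zero_div hφ.1.le hφ.2, mul_zero]

/-- Induction on n: cot φ (cos 2nφ − cos(2n+2)φ) = sin(2n+2)φ + sin 2nφ, and the sines integrate to
the increment of β. -/
theorem integral_one_sub_cos_mul_cot (n : ℕ) :
    IntervalIntegrable (fun φ : ℝ => Real.cos φ / Real.sin φ * (1 - Real.cos (2 * n * φ)))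
      volume 0 (Real.pi / 2) ∧
    ∫ φ in (0 : ℝ)..Real.pi / 2, Real.cos φ / Real.sin φ * (1 - Real.cos (2 * n * φ))
      = neumannBeta n := by
  have hsin : ∀ k : ℕ, k ≠ 0 → ∫ φ in (0 : ℝ)..Real.pi / 2, Real.sin (2 * k * φ)
      = (1 - (-1) ^ k) / (2 * k) := by
    intro k hk
    have hk' : (2 * (k : ℝ)) ≠ 0 := by positivity
    rw [intervalIntegral.integral_comp_mul_left _ hk', integral_sin,
      show 2 * (k : ℝ) * (Real.pi / 2) = k * Real.pi by ring, Real.cos_nat_mul_pi]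
    simp
    ring
  induction n with
  -- Here β₀ = 0, because the sums are empty and division by zero gives 0.
  | zero => simp [neumannBeta, harmonicNumber, altHarmonicNumber]
  | succ n ih =>
    have e : Set.EqOn
        (fun φ : ℝ => Real.cos φ / Real.sin φ * (1 - Real.cos (2 * (n + 1 : ℕ) * φ)))
        (fun φ => Real.cos φ / Real.sin φ * (1 - Real.cos (2 * n * φ))
          + (Real.sin (2 * (n + 1 : ℕ) * φ) + Real.sin (2 * n * φ)))
        (Set.uIcc 0 (Real.pi / 2)) := by
      intro φ hφ
      rw [Set.uIcc_of_le (by positivity)] at hφ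
      simp only
      rcases eq_or_lt_of_le hφ.1 with h0 | h0
      · simp [← h0]
      · have hs : Real.sin φ ≠ 0 :=
          (Real.sin_pos_of_pos_of_lt_pi h0 (by linarith [hφ.2, Real.pi_pos])).ne'
        have a : 2 * ((n + 1 : ℕ) : ℝ) * φ = (2 * n * φ + φ) + φ := by push_cast; ring
        rw [a, Real.cos_add (2 * n * φ + φ), Real.sin_add (2 * n * φ + φ), Real.cos_add,
          Real.sin_add]
        field_simp
        linear_combination (-Real.cos (2 * n * φ) * Real.cos φ
          + Real.sin (2 * n * φ) * Real.sin φ) * Real.sin_sq_add_cos_sq φ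
    have c1 : IntervalIntegrable (fun φ : ℝ => Real.sin (2 * (n + 1 : ℕ) * φ)) volume 0
        (Real.pi / 2) := Continuous.intervalIntegrable (by fun_prop) _ _
    have c2 : IntervalIntegrable (fun φ : ℝ => Real.sin (2 * n * φ)) volume 0
        (Real.pi / 2) := Continuous.intervalIntegrable (by fun_prop) _ _
    refine ⟨(ih.1.add (c1.add c2)).congr fun φ hφ => (e (Set.uIoc_subset_uIcc hφ)).symm, ?_⟩
    rw [intervalIntegral.integral_congr e, intervalIntegral.integral_add ih.1 (c1.add c2),
      intervalIntegral.integral_add c1 c2, ih.2, hsin (n + 1) (Nat.succ_ne_zero n)]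
    simp only [neumannBeta, harmonicNumber, altHarmonicNumber]
    rw [Finset.sum_Icc_succ_top (by omega), Finset.sum_Icc_succ_top (by omega)]
    rcases Nat.eq_zero_or_pos n with rfl | hn
    · norm_num
    · rw [hsin n hn.ne']
      obtain ⟨m, rfl⟩ := Nat.exists_eq_succ_of_ne_zero hn.ne'
      have h1 : ((m : ℝ) + 1) ≠ 0 := by positivity
      have h2 : ((m : ℝ) + 1 + 1) ≠ 0 := by positivity
      simp only [Nat.succ_eq_add_one, add_tsub_cancel_right, pow_succ]
      push_cast
      field_simp
      ring

theorem integral_cosIntegralEntire_two_mul {n : ℕ} (hn : n ≠ 0) :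
    ∫ t in Set.Ioi (0 : ℝ), cosIntegralEntire t * besselIntegral (2 * n : ℕ) t / t
      = neumannBeta n / (2 * n) := by
  have hp : (0 : ℝ) ≤ Real.pi / 2 := by positivity
  rw [integral_cosIntegralEntire_eq, ← (integral_one_sub_cos_mul_cot n).2,
    ← intervalIntegral.integral_div, intervalIntegral.integral_of_le hp,
    intervalIntegral.integral_of_le hp, integral_Ioc_eq_integral_Ioo,
    integral_Ioc_eq_integral_Ioo]
  refine setIntegral_congr_fun measurableSet_Ioo fun φ hφ => ?_
  have hc : 0 < Real.cos φ := Real.cos_pos_of_mem_Ioo ⟨by linarith [hφ.1], hφ.2⟩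
  rw [integral_one_sub_cos_mul_div hc (by omega)]
  push_cast
  ring

/-! ### Jacobi–Anger expansion and Graf's addition theorem -/

theorem summable_three_pow_mul_abs (a : ℝ) :
    Summable fun n : ℕ => 3 ^ n * |besselIntegral n a| := by
  refine Summable.of_nonneg_of_le (fun n => by positivity) (fun n => ?_)
    ((hasSum_pow_div_factorial_real (3 * |a / 2|)).summable.mul_right (Real.exp (|a / 2| ^ 2)))
  refine (mul_le_mul_of_nonneg_left (abs_le_mul_exp n a) (by positivity)).trans (le_of_eq ?_)
  rw [mul_pow]
  ring

theorem summable_abs_nat (a : ℝ) : Summable fun n : ℕ => |besselIntegral n a| := by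
  refine Summable.of_nonneg_of_le (fun n => abs_nonneg _) (fun n => ?_)
    (summable_three_pow_mul_abs a)
  exact le_mul_of_one_le_left (abs_nonneg _) (one_le_pow₀ (by norm_num))

theorem summable_abs_int (a : ℝ) : Summable fun n : ℤ => |besselIntegral n a| := by
  refine Summable.of_nat_of_neg (summable_abs_nat a) ?_
  refine (summable_abs_nat a).congr fun n => ?_
  rw [neg_order, abs_mul, abs_zpow, abs_neg, abs_one, one_zpow, one_mul]

theorem exp_sin_periodic (a : ℝ) :
    Function.Periodic (fun θ : ℝ => Complex.exp ((a * Real.sin θ : ℝ) * Complex.I))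
      (2 * Real.pi) := by
  intro θ
  simp only [Real.sin_add_two_pi]

/-- The Jacobi–Anger expansion. -/
theorem hasSum_jacobiAnger (a θ : ℝ) :
    HasSum (fun n : ℤ => (besselIntegral n a : ℂ) * Complex.exp ((n * θ : ℝ) * Complex.I))
      (Complex.exp ((a * Real.sin θ : ℝ) * Complex.I)) := by
  have : Fact (0 < 2 * Real.pi) := ⟨Real.two_pi_pos⟩
  have hπ : (Real.pi : ℂ) ≠ 0 := by exact_mod_cast Real.pi_ne_zero
  let f : C(AddCircle (2 * Real.pi), ℂ) :=
    ⟨(exp_sin_periodic a).lift, continuous_quot_lift _ (by fun_prop)⟩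
  have hf : ∀ x : ℝ, f (x : AddCircle (2 * Real.pi))
      = Complex.exp ((a * Real.sin x : ℝ) * Complex.I) := fun x => rfl
  have hfour : ∀ (n : ℤ) (x : ℝ), fourier n (x : AddCircle (2 * Real.pi))
      = Complex.exp ((n * x : ℝ) * Complex.I) := by
    intro n x
    rw [fourier_coe_apply]
    congr 1
    push_cast
    field_simp
  have hcoeff : ∀ n : ℤ, fourierCoeff f n = besselIntegral n a := by
    intro n
    rw [fourierCoeff_eq_intervalIntegral f n 0, ofReal_eq_integral_exp, zero_add,
      Complex.real_smul]
    congr 1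
    · push_cast; rfl
    · congr 1
      ext x
      rw [hf, hfour, smul_eq_mul, ← Complex.exp_add]
      congr 1
      push_cast
      ring
  have hs : Summable (fourierCoeff f) := by
    simp_rw [funext hcoeff]
    refine Summable.of_norm ?_
    simpa only [Complex.norm_real, Real.norm_eq_abs] using summable_abs_int a
  have h := has_pointwise_sum_fourier_series_of_summable hs (θ : AddCircle (2 * Real.pi))
  simpa only [hcoeff, hfour, hf, smul_eq_mul] using h

theorem integral_exp_cos (n : ℤ) (t : ℝ) :
    (1 / (2 * Real.pi)) * ∫ θ in (0 : ℝ)..2 * Real.pi,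
      Complex.exp ((n * θ + t * Real.cos θ : ℝ) * Complex.I)
      = Complex.exp ((n * (Real.pi / 2) : ℝ) * Complex.I) * besselIntegral n t := by
  have hper : Function.Periodic
      (fun θ : ℝ => Complex.exp ((t * Real.sin θ - n * θ : ℝ) * Complex.I)) (2 * Real.pi) := by
    intro θ
    have e : ((t * Real.sin (θ + 2 * Real.pi) - n * (θ + 2 * Real.pi) : ℝ) : ℂ) * Complex.I
        = ((t * Real.sin θ - n * θ : ℝ) : ℂ) * Complex.I
          + ((-n : ℤ) : ℂ) * (2 * Real.pi * Complex.I) := by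
      rw [Real.sin_add_two_pi]
      push_cast
      ring
    simp only [e, Complex.exp_add, Complex.exp_int_mul_two_pi_mul_I, mul_one]
  have h1 := hper.intervalIntegral_add_eq (Real.pi / 2 - 2 * Real.pi) 0
  have h2 := intervalIntegral.integral_comp_sub_left (a := 0) (b := 2 * Real.pi)
    (fun θ : ℝ => Complex.exp ((t * Real.sin θ - n * θ : ℝ) * Complex.I)) (Real.pi / 2)
  rw [sub_add_cancel, zero_add] at h1
  rw [sub_zero, h1] at h2
  have e : ∀ θ : ℝ, Complex.exp ((n * θ + t * Real.cos θ : ℝ) * Complex.I)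
      = Complex.exp ((n * (Real.pi / 2) : ℝ) * Complex.I)
        * Complex.exp ((t * Real.sin (Real.pi / 2 - θ) - n * (Real.pi / 2 - θ) : ℝ)
          * Complex.I) := by
    intro θ
    rw [Real.sin_pi_div_two_sub, ← Complex.exp_add]
    congr 1
    push_cast
    ring
  simp_rw [e]
  rw [intervalIntegral.integral_const_mul, h2, ofReal_eq_integral_exp]
  ring

/-- With a + it = re^{iα}, a sin θ + t cos θ = r sin(θ + α), and the integral over a period ignores
the shift α. -/
theorem zero_sqrt_eq (a t : ℝ) :
    (besselIntegral 0 √(a ^ 2 + t ^ 2) : ℂ) = (1 / (2 * Real.pi)) *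
      ∫ θ in (0 : ℝ)..2 * Real.pi,
        Complex.exp ((a * Real.sin θ + t * Real.cos θ : ℝ) * Complex.I) := by
  set r := √(a ^ 2 + t ^ 2) with hr
  set α := Complex.arg (a + t * Complex.I) with hα
  have hn : ‖(a + t * Complex.I : ℂ)‖ = r := Complex.norm_add_mul_I a t
  have hc : r * Real.cos α = a := by rw [← hn, hα, Complex.norm_mul_cos_arg]; simp
  have hs : r * Real.sin α = t := by rw [← hn, hα, Complex.norm_mul_sin_arg]; simp
  have h1 := (exp_sin_periodic r).intervalIntegral_add_eq α 0
  have h2 := intervalIntegral.integral_comp_add_right (a := 0) (b := 2 * Real.pi)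
    (fun θ : ℝ => Complex.exp ((r * Real.sin θ : ℝ) * Complex.I)) α
  rw [zero_add] at h1
  rw [zero_add, add_comm (2 * Real.pi), h1] at h2
  rw [ofReal_eq_integral_exp]
  have e : ∀ θ : ℝ, a * Real.sin θ + t * Real.cos θ = r * Real.sin (θ + α) := by
    intro θ
    rw [Real.sin_add]
    linear_combination -Real.sin θ * hc - Real.cos θ * hs
  simp_rw [e, h2]
  simp

/-- The Jacobi–Anger series in a, multiplied by e^{it cos θ}, is integrated termwise over θ. Each
term yields the phase e^{inπ/2}, of which the real part is kept. -/
theorem hasSum_graf_int (a t : ℝ) :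
    HasSum (fun n : ℤ => Real.cos (n * (Real.pi / 2)) * (besselIntegral n a * besselIntegral n t))
      (besselIntegral 0 √(a ^ 2 + t ^ 2)) := by
  have h := intervalIntegral.hasSum_integral_of_dominated_convergence (μ := volume)
    (a := 0) (b := 2 * Real.pi)
    (F := fun (n : ℤ) (θ : ℝ) => (besselIntegral n a : ℂ)
      * Complex.exp ((n * θ + t * Real.cos θ : ℝ) * Complex.I))
    (f := fun θ : ℝ => Complex.exp ((a * Real.sin θ + t * Real.cos θ : ℝ) * Complex.I))
    (fun (n : ℤ) _ => |besselIntegral n a|)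
    (fun n => Continuous.aestronglyMeasurable (by fun_prop))
    (fun n => Filter.Eventually.of_forall fun θ _ => by
      rw [norm_mul, Complex.norm_exp_ofReal_mul_I, mul_one, Complex.norm_real, Real.norm_eq_abs])
    (Filter.Eventually.of_forall fun θ _ => summable_abs_int a)
    (Continuous.intervalIntegrable (by fun_prop) _ _)
    (Filter.Eventually.of_forall fun θ _ => by
      have e : ∀ x : ℝ, Complex.exp ((x + t * Real.cos θ : ℝ) * Complex.I)
          = Complex.exp ((x : ℝ) * Complex.I)
            * Complex.exp ((t * Real.cos θ : ℝ) * Complex.I) := by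
        intro x
        rw [← Complex.exp_add]
        congr 1
        push_cast
        ring
      simp_rw [e, ← mul_assoc]
      exact (hasSum_jacobiAnger a θ).mul_right _)
  replace h := h.mul_left (1 / (2 * (Real.pi : ℂ)))
  rw [← zero_sqrt_eq] at h
  replace h := Complex.hasSum_re h
  rw [Complex.ofReal_re] at h
  refine h.congr_fun fun n => ?_
  rw [intervalIntegral.integral_const_mul, mul_left_comm (1 / (2 * (Real.pi : ℂ))),
    integral_exp_cos, mul_left_comm (besselIntegral n a : ℂ), ← Complex.ofReal_mul, Complex.re_mul_ofReal, Complex.exp_ofReal_mul_I_re]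

/-- Graf's addition theorem for orthogonal arguments. -/
theorem hasSum_graf (a t : ℝ) :
    HasSum (fun m : ℕ => 2 * (-1) ^ (m + 1) *
        (besselIntegral (2 * (m + 1) : ℕ) a * besselIntegral (2 * (m + 1) : ℕ) t))
      (besselIntegral 0 √(a ^ 2 + t ^ 2) - besselIntegral 0 a * besselIntegral 0 t) := by
  -- Pairing n with −n counts n = 0 twice, which adds an extra J₀(a)J₀(t) to the sum; odd orders
  -- vanish since cos(nπ/2) = 0.
  have h := (hasSum_graf_int a t).nat_add_neg
  have hi : Function.Injective fun m : ℕ => 2 * m := fun x y hxy => by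
    simpa using hxy
  rw [← hi.hasSum_iff] at h
  · rw [← hasSum_nat_add_iff' 1] at h
    have hlim : besselIntegral 0 √(a ^ 2 + t ^ 2)
          + Real.cos ((0 : ℤ) * (Real.pi / 2)) * (besselIntegral 0 a * besselIntegral 0 t)
          - ∑ i ∈ Finset.range 1, ((fun n : ℕ => Real.cos ((n : ℤ) * (Real.pi / 2))
            * (besselIntegral n a * besselIntegral n t)
            + Real.cos ((-(n : ℤ) : ℤ) * (Real.pi / 2))
            * (besselIntegral (-n) a * besselIntegral (-n) t)) ∘ fun m => 2 * m) i
        = besselIntegral 0 √(a ^ 2 + t ^ 2) - besselIntegral 0 a * besselIntegral 0 t := by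
      simp
    rw [← hlim]
    refine h.congr_fun fun m => ?_
    have e : (((2 * (m + 1) : ℕ) : ℤ) : ℝ) * (Real.pi / 2) = (m + 1 : ℕ) * Real.pi := by
      push_cast; ring
    have e2 : ((-((2 * (m + 1) : ℕ) : ℤ) : ℤ) : ℝ) * (Real.pi / 2)
        = -((m + 1 : ℕ) * Real.pi) := by
      push_cast; ring
    have e3 : ((-1 : ℝ) ^ ((2 * (m + 1) : ℕ) : ℤ)) = 1 := by
      rw [zpow_natCast, pow_mul]; simp
    simp only [Function.comp, e, e2, Real.cos_neg, Real.cos_nat_mul_pi, neg_order, e3]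
    ring
  · intro n hn
    have hodd : Odd n := by
      rw [← Nat.not_even_iff_odd]
      rintro ⟨k, hk⟩
      exact hn ⟨k, by simp only; omega⟩
    obtain ⟨k, rfl⟩ := hodd
    have e : Real.cos (((2 * k + 1 : ℕ) : ℝ) * (Real.pi / 2)) = 0 := by
      rw [Real.cos_eq_zero_iff]
      exact ⟨k, by push_cast; ring⟩
    simp only [Int.cast_natCast, Int.cast_neg, neg_mul, Real.cos_neg, e, zero_mul, add_zero]

/-! ### Termwise integration of Graf's series -/

theorem graf_term_le (a : ℝ) (m : ℕ) {t : ℝ} (ht : 0 < t) :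
    ‖2 * (-1) ^ (m + 1) * besselIntegral (2 * (m + 1) : ℕ) a
      * (cosIntegralEntire t * besselIntegral (2 * (m + 1) : ℕ) t / t)‖
      ≤ 80 * (3 ^ (2 * (m + 1)) * |besselIntegral (2 * (m + 1) : ℕ) a|) * majorant t := by
  have h := abs_cosIntegralEntire_mul_div_le (2 * (m + 1)) ht
  rw [norm_mul, norm_mul, norm_mul, norm_pow, norm_neg, norm_one, one_pow, mul_one,
    Real.norm_eq_abs, Real.norm_eq_abs, Real.norm_eq_abs, abs_of_pos (two_pos : (0 : ℝ) < 2)]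
  refine (mul_le_mul_of_nonneg_left h (by positivity)).trans (le_of_eq ?_)
  ring

theorem summable_graf_bound (a : ℝ) :
    Summable fun m : ℕ =>
      80 * (3 ^ (2 * (m + 1)) * |besselIntegral (2 * (m + 1) : ℕ) a|) := by
  refine Summable.mul_left _ ?_
  have hi : Function.Injective fun m : ℕ => 2 * (m + 1) := fun x y hxy => by
    simpa using hxy
  exact (summable_three_pow_mul_abs a).comp_injective hi

theorem hasSum_graf_cosIntegral (a t : ℝ) :
    HasSum (fun m : ℕ => 2 * (-1) ^ (m + 1) * besselIntegral (2 * (m + 1) : ℕ) a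
        * (cosIntegralEntire t * besselIntegral (2 * (m + 1) : ℕ) t / t))
      (cosIntegralEntire t * besselIntegral 0 √(a ^ 2 + t ^ 2) / t
        - besselIntegral 0 a * (cosIntegralEntire t * besselIntegral 0 t / t)) := by
  have h := (hasSum_graf a t).mul_left (cosIntegralEntire t / t)
  have e : cosIntegralEntire t * besselIntegral 0 √(a ^ 2 + t ^ 2) / t
        - besselIntegral 0 a * (cosIntegralEntire t * besselIntegral 0 t / t)
      = cosIntegralEntire t / t *
        (besselIntegral 0 √(a ^ 2 + t ^ 2) - besselIntegral 0 a * besselIntegral 0 t) := by ring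
  rw [e]
  exact h.congr_fun fun m => by ring

/-- The difference from the order-0 term is the sum of the Graf series, hence bounded by a multiple
of `majorant`; the order-0 term is integrable by itself. -/
theorem integrableOn_cosIntegralEntire_mul_sqrt (a : ℝ) :
    IntegrableOn (fun t => cosIntegralEntire t * besselIntegral 0 √(a ^ 2 + t ^ 2) / t)
      (Set.Ioi 0) := by
  have h0 := (integrableOn_cosIntegralEntire_mul_div 0).const_mul (besselIntegral 0 a)
  rw [Nat.cast_zero] at h0
  have hJ := continuous 0
  have hd : IntegrableOn
      (fun t => cosIntegralEntire t * besselIntegral 0 √(a ^ 2 + t ^ 2) / t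
        - besselIntegral 0 a * (cosIntegralEntire t * besselIntegral 0 t / t)) (Set.Ioi 0) := by
    refine (integrableOn_majorant.const_mul
      (∑' m : ℕ, 80 * (3 ^ (2 * (m + 1)) * |besselIntegral (2 * (m + 1) : ℕ) a|))).mono' ?_ ?_
    · have hC := continuous_cosIntegralEntire
      have m1 := hC.measurable
      have m2 := hJ.measurable
      exact Measurable.aestronglyMeasurable (by fun_prop)
    · filter_upwards [ae_restrict_mem measurableSet_Ioi] with t ht
      rw [← (hasSum_graf_cosIntegral a t).tsum_eq]
      exact tsum_of_norm_bounded ((summable_graf_bound a).hasSum.mul_right _)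
        fun m => graf_term_le a m ht
  exact (hd.add h0).congr (Filter.Eventually.of_forall fun t => by simp)

theorem hasSum_integral_cosIntegralEntire (a : ℝ) :
    HasSum (fun m : ℕ => (-1 : ℝ) ^ (m + 1) / ((m + 1 : ℕ) : ℝ)
        * besselIntegral (2 * (m + 1) : ℕ) a * neumannBeta (m + 1))
      (∫ t in Set.Ioi (0 : ℝ),
        cosIntegralEntire t * besselIntegral 0 √(a ^ 2 + t ^ 2) / t) := by
  have h := hasSum_integral_of_dominated_convergence (μ := volume.restrict (Set.Ioi 0))
    (F := fun (m : ℕ) (t : ℝ) => 2 * (-1) ^ (m + 1) * besselIntegral (2 * (m + 1) : ℕ) a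
        * (cosIntegralEntire t * besselIntegral (2 * (m + 1) : ℕ) t / t))
    (fun (m : ℕ) t => 80 * (3 ^ (2 * (m + 1)) * |besselIntegral (2 * (m + 1) : ℕ) a|) * majorant t)
    (fun m => ((integrableOn_cosIntegralEntire_mul_div _).const_mul _).aestronglyMeasurable)
    (fun m => by
      filter_upwards [ae_restrict_mem measurableSet_Ioi] with t ht using graf_term_le a m ht)
    (Filter.Eventually.of_forall fun t => (summable_graf_bound a).mul_right _)
    (by simp_rw [tsum_mul_right]; exact integrableOn_majorant.const_mul _)
    (Filter.Eventually.of_forall fun t => hasSum_graf_cosIntegral a t)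
  have h0 := (integrableOn_cosIntegralEntire_mul_div 0).const_mul (besselIntegral 0 a)
  rw [Nat.cast_zero] at h0
  -- The order-0 term of Graf's series contributes nothing, so the integral of the difference is the
  -- full integral.
  rw [integral_sub (integrableOn_cosIntegralEntire_mul_sqrt a) h0, integral_const_mul,
    integral_cosIntegralEntire_zero, mul_zero, sub_zero] at h
  refine h.congr_fun fun m => ?_
  rw [integral_const_mul, integral_cosIntegralEntire_two_mul (Nat.succ_ne_zero m)]
  have : ((m + 1 : ℕ) : ℝ) ≠ 0 := by positivity
  field_simp

end besselIntegral

/-- For every real `a`, the integral of `[γ + log t - Ci(t)] J_0(√(a² + t²)) / t` over `(0, ∞)`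
converges absolutely, and the series `∑_{n ≥ 1} (-1)^n β_n J_{2n}(a) / n` converges to it
(the index `n ≥ 1` is written `m + 1` with `m : ℕ`). -/
theorem corollary5 (a : ℝ) :
    IntegrableOn
      (fun t : ℝ => (Real.eulerMascheroniConstant + Real.log t - cosIntegral t)
        * besselJ 0 (Real.sqrt (a ^ 2 + t ^ 2)) / t) (Set.Ioi 0) ∧
    HasSum
      (fun m : ℕ => (-1 : ℝ) ^ (m + 1) / ((m + 1 : ℕ) : ℝ)
        * besselJ (2 * (m + 1)) a * neumannBeta (m + 1))
      (∫ t in Set.Ioi (0 : ℝ),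
        (Real.eulerMascheroniConstant + Real.log t - cosIntegral t)
          * besselJ 0 (Real.sqrt (a ^ 2 + t ^ 2)) / t) := by
  have h0 : ∀ x : ℝ, besselJ 0 x = besselIntegral 0 x := fun x =>
    (besselIntegral.eq_besselJ 0 x).symm
  simp_rw [eulerMascheroni_add_log_sub_cosIntegral, h0, ← besselIntegral.eq_besselJ]
  exact ⟨besselIntegral.integrableOn_cosIntegralEntire_mul_sqrt a,
    besselIntegral.hasSum_integral_cosIntegralEntire a⟩
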